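/- Let $\mathcal B_n$ be the braid group on $n$ strands with Artin generators $x_1,\dots,x_{n-1}$. A braid is positive if it is a product of the generators $x_i$, and a positive braid is simple if it can be written as a product of generators in which no generator is repeated. The degree $\deg\beta$ of a braid is its exponent sum. For a (possibly empty) sequence $A=(a_1\ge a_2\ge\dots\ge a_r\ge 2)$ put $s_i=a_1+\dots+a_i$ (so $s_0=0$) and, if $s_r\le n$, $$\beta_A=(x_1x_2\cdots x_{s_1-1})(x_{s_1+1}\cdots x_{s_2-1})\cdots(x_{s_{r-1}+1}\cdots x_{s_r-1})\in\mathcal B_n .$$ (a) For every $n\ge 0$, a positive braid in $\mathcal B_n$ is simple if and only if it is conjugate in $\mathcal B_n$ to $\beta_A$ for some sequence $A$ as above with $s_r\le n$. Consider (nonempty) oriented links up to isotopy, presented as closures $\widehat\beta$ of braids $\beta\in\mathcal B_n$, $n\ge1$, up to Markov moves. There is exactly one function $P$ from oriented links to $\mathbb C[l^{\pm1},m^{\pm1}]$ (the HOMFLY polynomial) with $P(\bigcirc)=1$ and $l\,P(L_+)+l^{-1}P(L_-)+m\,P(L_0)=0$ for all skein triples of closed braids $$L_+=\widehat{\alpha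 x_i^{-1}\gamma},\qquad L_-=\widehat{\alpha x_i\gamma},\qquad L_0=\widehat{\alpha\gamma}\qquad(\alpha,\gamma\in\mathcal B_n,\ 1\le i<n).$$ Write $P_n(\beta)=P(\widehat\beta)$, and let $\nabla_n(\beta)$, $V_n(\beta)$, $D_n(\beta)$ be the elements of $\mathbb C(s)$ obtained from $P_n(\beta)$ by the specializations $(l,m)=(\iota,\iota(s^{-1}-s))$ (Alexander–Conway), $(l,m)=(\iota s^2,\iota(s-s^{-1}))$ (Jones) and $(l,m)=(s,-2)$, respectively, where $\iota^2=-1$. (b) Let $n\ge1$. For every sequence $A$ as above with $s_r\le n$, $$P_n(\beta_A)=\Big(-\frac{l+l^{-1}}{m}\Big)^{n-s_r+r-1}.$$ More generally, for every simple braid $\beta\in\mathcal B_n$ one has $n-\deg\beta-1\ge 0$ and $$P_n(\beta)=\Big(-\frac{l+l^{-1}}{m}\Big)^{n-\deg\beta-1},\qquad \nabla_n(\beta)=\begin{cases}1&\text{if }\deg\beta=n-1,\\0&\text{if }\deg\beta\ne n-1,\end{cases}$$ $$V_n(\beta)=\Big(-\frac{s^2+1}{s}\Big)^{n-\deg\beta-1},\qquad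 D_n(\beta)=\Big(\frac{s^2+1}{2s}\Big)^{n-\deg\beta-1}.$$ -/

import Mathlib

namespace SimpleBraid

/-! ### The braid group and simple braids -/

/-- Indices of the Artin generators `x_1, …, x_{n-1}` of the braid group on `n` strands. -/
abbrev ArtinIndex (n : ℕ) : Type := {i : ℕ // 1 ≤ i ∧ i < n}

/-- Artin's relations: `x_i x_j = x_j x_i` for `|i - j| ≥ 2` and
`x_i x_{i+1} x_i = x_{i+1} x_i x_{i+1}`. -/
def braidRels (n : ℕ) : Set (FreeGroup (ArtinIndex n)) :=
  {r | ∃ i j : ArtinIndex n, i.1 + 2 ≤ j.1 ∧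
    r = (FreeGroup.of i * FreeGroup.of j) * (FreeGroup.of j * FreeGroup.of i)⁻¹} ∪
  {r | ∃ i j : ArtinIndex n, j.1 = i.1 + 1 ∧
    r = (FreeGroup.of i * FreeGroup.of j * FreeGroup.of i) *
      (FreeGroup.of j * FreeGroup.of i * FreeGroup.of j)⁻¹}

/-- The braid group on `n` strands. -/
abbrev BraidGroup (n : ℕ) : Type := PresentedGroup (braidRels n)

/-- The Artin generator `x_i`. -/
def gen {n : ℕ} (i : ArtinIndex n) : BraidGroup n := PresentedGroup.of i

/-- The Artin generator `x_i` for a natural number `i`. It is only used for `1 ≤ i < n`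
(for all other `i` the value is `1`). -/
def x (n i : ℕ) : BraidGroup n := if h : 1 ≤ i ∧ i < n then gen ⟨i, h⟩ else 1

/-- Positive braids: the elements of the submonoid generated by the Artin generators. -/
def positiveBraids (n : ℕ) : Submonoid (BraidGroup n) :=
  Submonoid.closure (Set.range (gen (n := n)))

/-- A braid is simple if it has a positive presentation without repeated generators. -/
def IsSimple {n : ℕ} (β : BraidGroup n) : Prop :=
  ∃ w : List (ArtinIndex n), w.Nodup ∧ (w.map gen).prod = β

/-- The exponent sum as a homomorphism (each `x_i` has degree `1`). -/
def degreeHom (n : ℕ) : BraidGroup n →* Multiplicative ℤ :=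
  PresentedGroup.toGroup (f := fun _ : ArtinIndex n => Multiplicative.ofAdd (1 : ℤ)) (by
    rintro r (⟨i, j, _, rfl⟩ | ⟨i, j, _, rfl⟩) <;> simp)

/-- The degree (exponent sum) of a braid; on positive braids it is the word length. -/
def degree {n : ℕ} (β : BraidGroup n) : ℤ := Multiplicative.toAdd (degreeHom n β)

/-- The indices of the word
`(x_{s+1} … x_{s+a₁-1}) (x_{s+a₁+1} … x_{s+a₁+a₂-1}) …` for a list `A = (a₁, a₂, …)`. -/
def canonicalWord : ℕ → List ℕ → List ℕ
  | _, [] => []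
  | s, a :: A => List.range' (s + 1) (a - 1) ++ canonicalWord (s + a) A

/-- `β_A = (x_1 … x_{s_1-1}) (x_{s_1+1} … x_{s_2-1}) … (x_{s_{r-1}+1} … x_{s_r-1})`,
with `s_i = a_1 + … + a_i`, in the braid group on `n` strands. -/
def canonicalBraid (n : ℕ) (A : List ℕ) : BraidGroup n :=
  ((canonicalWord 0 A).map (x n)).prod

/-! ### Closed braids and oriented links -/

/-- The inclusion of the `n`-strand braid group into the `(n+1)`-strand one, `x_i ↦ x_i`
(add a last unbraided strand). -/
def incl (n : ℕ) : BraidGroup n →* BraidGroup (n + 1) :=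
  PresentedGroup.toGroup
    (f := fun i : ArtinIndex n => gen (⟨i.1, i.2.1, Nat.lt_succ_of_lt i.2.2⟩ : ArtinIndex (n + 1)))
    (by
      rintro r (⟨i, j, h, rfl⟩ | ⟨i, j, h, rfl⟩)
      · simp only [map_mul, map_inv, FreeGroup.lift_apply_of]
        exact PresentedGroup.one_of_mem (rels := braidRels (n + 1)) (Or.inl ⟨_, _, h, rfl⟩)
      · simp only [map_mul, map_inv, FreeGroup.lift_apply_of]
        exact PresentedGroup.one_of_mem (rels := braidRels (n + 1)) (Or.inr ⟨_, _, h, rfl⟩))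

/-- A closed braid: a braid on at least one strand, thought of as the oriented link diagram
obtained by joining the top ends to the bottom ends. -/
structure ClosedBraid where
  strands : ℕ
  pos : 0 < strands
  braid : BraidGroup strands

/-- The Markov moves on closed braids: conjugation, and positive and negative stabilization. -/
inductive MarkovMove : ClosedBraid → ClosedBraid → Prop
  | conj {n : ℕ} (hn : 0 < n) (α γ : BraidGroup n) :
      MarkovMove ⟨n, hn, α⟩ ⟨n, hn, γ * α * γ⁻¹⟩
  | stab_pos {n : ℕ} (hn : 0 < n) (α : BraidGroup n) :
      MarkovMove ⟨n, hn, α⟩ ⟨n + 1, Nat.succ_pos n, incl n α * x (n + 1) n⟩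
  | stab_neg {n : ℕ} (hn : 0 < n) (α : BraidGroup n) :
      MarkovMove ⟨n, hn, α⟩ ⟨n + 1, Nat.succ_pos n, incl n α * (x (n + 1) n)⁻¹⟩

/-- Isotopy classes of (nonempty) oriented links in the 3-sphere. By the theorems of Alexander
and Markov these are the closed braids up to the equivalence relation generated by the
Markov moves. -/
def OrientedLink : Type := Quot MarkovMove

/-- The oriented link given by the closure of a braid on `n ≥ 1` strands. -/
def braidClosure {n : ℕ} (hn : 0 < n) (β : BraidGroup n) : OrientedLink := Quot.mk _ ⟨n, hn, β⟩

/-- The unknot: the closure of the one-strand braid. -/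
def unknot : OrientedLink := braidClosure Nat.one_pos (1 : BraidGroup 1)

/-- Skein triples `(L₊, L₋, L₀)`: three closed braids that are the same except at one crossing
between the strands in positions `i` and `i + 1`. In the convention of the skein relation used
here the crossing of the Artin generator `x_i` is the one of `L₋`, and that of `x_i⁻¹` is the
one of `L₊`. -/
def SkeinTriple (Lp Lm L0 : OrientedLink) : Prop :=
  ∃ (n : ℕ) (hn : 0 < n) (i : ArtinIndex n) (α β : BraidGroup n),
    Lp = braidClosure hn (α * (gen i)⁻¹ * β) ∧
    Lm = braidClosure hn (α * gen i * β) ∧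
    L0 = braidClosure hn (α * β)

/-! ### The HOMFLY polynomial and its specializations -/

/-- The ring `ℂ[l^{±1}, m^{±1}]`: Laurent polynomials in `m` over Laurent polynomials in `l`. -/
abbrev HomflyRing : Type := LaurentPolynomial (LaurentPolynomial ℂ)

/-- `l ^ k`, for an integer `k`. -/
noncomputable def lPow (k : ℤ) : HomflyRing := LaurentPolynomial.C (LaurentPolynomial.T k)

/-- `m ^ k`, for an integer `k`. -/
noncomputable def mPow (k : ℤ) : HomflyRing := LaurentPolynomial.T k

/-- `P` is the HOMFLY polynomial: an invariant of oriented links that is `1` on the unknot and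
satisfies the skein relation `l P(L₊) + l⁻¹ P(L₋) + m P(L₀) = 0`. -/
def IsHomfly (P : OrientedLink → HomflyRing) : Prop :=
  P unknot = 1 ∧
  ∀ Lp Lm L0 : OrientedLink, SkeinTriple Lp Lm L0 →
    lPow 1 * P Lp + lPow (-1) * P Lm + mPow 1 * P L0 = 0

/-- The element `-(l + l⁻¹) / m`. -/
noncomputable def delta : HomflyRing := -((lPow 1 + lPow (-1)) * mPow (-1))

/-- The variable `s`, in the field `ℂ(s)`. -/
noncomputable abbrev sVar : RatFunc ℂ := RatFunc.X

/-- The imaginary unit, as a constant in `ℂ(s)`. -/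
noncomputable abbrev iota : RatFunc ℂ := algebraMap ℂ (RatFunc ℂ) Complex.I

/-- The specialization `l ↦ u`, `m ↦ v` (over `ℂ`). -/
noncomputable def specialize (u v : (RatFunc ℂ)ˣ) : HomflyRing →+* RatFunc ℂ :=
  LaurentPolynomial.eval₂ (LaurentPolynomial.eval₂ (algebraMap ℂ (RatFunc ℂ)) u) v

theorem s_ne_zero : sVar ≠ 0 := RatFunc.X_ne_zero

theorem iota_ne_zero : iota ≠ 0 := by
  simp [iota, Complex.I_ne_zero]

theorem s_sub_inv_ne_zero : sVar - sVar⁻¹ ≠ 0 := by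
  intro h
  have h0 := s_ne_zero
  have h1 : sVar * sVar = 1 := by
    field_simp at h
    linear_combination h
  have h2 : (Polynomial.X * Polynomial.X : Polynomial ℂ) = 1 := by
    apply RatFunc.algebraMap_injective ℂ
    simpa [RatFunc.algebraMap_X] using h1
  have h3 := congrArg (Polynomial.eval 0) h2
  simp at h3

/-- The Alexander–Conway specialization `l = ι`, `m = ι (s⁻¹ - s)`. -/
noncomputable def conway (P : OrientedLink → HomflyRing) (L : OrientedLink) : RatFunc ℂ :=
  specialize (Units.mk0 iota iota_ne_zero)
    (Units.mk0 (iota * (sVar⁻¹ - sVar)) (mul_ne_zero iota_ne_zero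
      (by rw [← neg_sub]; exact neg_ne_zero.mpr s_sub_inv_ne_zero))) (P L)

/-- The Jones specialization `l = ι s²`, `m = ι (s - s⁻¹)`. -/
noncomputable def jones (P : OrientedLink → HomflyRing) (L : OrientedLink) : RatFunc ℂ :=
  specialize (Units.mk0 (iota * sVar ^ 2) (mul_ne_zero iota_ne_zero (pow_ne_zero 2 s_ne_zero)))
    (Units.mk0 (iota * (sVar - sVar⁻¹)) (mul_ne_zero iota_ne_zero s_sub_inv_ne_zero)) (P L)

/-- The degenerate specialization `D`: `l = s`, `m = -2`. -/
noncomputable def dPoly (P : OrientedLink → HomflyRing) (L : OrientedLink) : RatFunc ℂ :=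
  specialize (Units.mk0 sVar s_ne_zero)
    (Units.mk0 (-2) (neg_ne_zero.mpr two_ne_zero)) (P L)

end SimpleBraid

open SimpleBraid

namespace SimpleBraid

/-! Conjugacy. Up to conjugation, a word without repeated letters can be put in increasing order,
because the Artin indices form a path (`isConj_prod_of_perm_range`). The sorted word splits into
runs of consecutive generators. Adjacent runs are exchanged by conjugating with a power of the run
`d` spanning both, since `d x_i = x_{i+1} d` and the full twist is central (`run_pow_conj_blocks`).
Hence the runs may be arranged by decreasing length.

Conversely, the permutation of a word with `r` distinct letters has at least `n - r` cycles, with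
equality when no letter repeats. The number of cycles and the degree are conjugacy invariants, so a
positive word conjugate to a simple braid has as many distinct letters as letters
(`IsSimple.of_isConj`). Cycles are counted linearly, as the dimension of the space of invariant
labellings.

HOMFLY. Modulo the skein relation every braid reduces to braids containing the last generator at
most once. By stabilization and conjugation, every skein invariant with values in a module therefore
lies in the span of its value on the unknot (`IsSkeinInvariant.mem_span_unknot`). Applied to a
difference of two solutions, this is uniqueness. For existence it is applied to the family of all
quantum `gl_N` state sums at infinitely many `q`: one ring element then evaluates to the normalized
state sum for all parameters at once, and an element of the ring is determined by these evaluations,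
so the skein relation lifts.

Values. In a simple braid the last generator occurs once, and a stabilization is undone, or not at
all, and an unknotted component splits off with factor `delta` (`IsHomfly.nodup_word`). -/

theorem gen_comm {n : ℕ} {i j : ArtinIndex n} (h : i.1 + 2 ≤ j.1) :
    gen i * gen j = gen j * gen i := by
  have := PresentedGroup.one_of_mem (rels := braidRels n) (Or.inl ⟨i, j, h, rfl⟩)
  rw [map_mul, map_inv, mul_inv_eq_one, map_mul, map_mul] at this
  exact this

theorem gen_braid {n : ℕ} {i j : ArtinIndex n} (h : j.1 = i.1 + 1) :
    gen i * gen j * gen i = gen j * gen i * gen j := by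
  have := PresentedGroup.one_of_mem (rels := braidRels n) (Or.inr ⟨i, j, h, rfl⟩)
  rw [map_mul, map_inv, mul_inv_eq_one, map_mul, map_mul, map_mul, map_mul] at this
  exact this

theorem x_eq_gen {n i : ℕ} (h : 1 ≤ i ∧ i < n) : x n i = gen ⟨i, h⟩ := dif_pos h

theorem x_val {n : ℕ} (i : ArtinIndex n) : x n i.1 = gen i := dif_pos i.2

theorem x_comm (n : ℕ) {i j : ℕ} (h : i + 2 ≤ j) : Commute (x n i) (x n j) := by
  unfold x
  split_ifs
  · exact gen_comm h
  · exact Commute.one_right _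
  · exact Commute.one_left _
  · exact Commute.one_left _

theorem x_braid {n i : ℕ} (hi : 1 ≤ i) (hn : i + 1 < n) :
    x n i * x n (i + 1) * x n i = x n (i + 1) * x n i * x n (i + 1) := by
  rw [x_eq_gen ⟨hi, by omega⟩, x_eq_gen ⟨by omega, hn⟩]
  exact gen_braid rfl

theorem map_gen_prod {n : ℕ} (w : List (ArtinIndex n)) :
    (w.map gen).prod = ((w.map Subtype.val).map (x n)).prod := by
  rw [List.map_map]
  congr 1
  exact List.map_congr_left fun i _ => (x_val i).symm

theorem closure_range_gen (n : ℕ) : Subgroup.closure (Set.range (gen (n := n))) = ⊤ :=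
  PresentedGroup.closure_range_of _

/-! ### Products of consecutive generators -/

/-- The product `x_a x_{a+1} … x_{a+k-1}`. -/
def run (n a k : ℕ) : BraidGroup n := ((List.range' a k).map (x n)).prod

theorem run_succ (n a k : ℕ) : run n a (k + 1) = x n a * run n (a + 1) k := by
  simp [run, List.range'_succ]

theorem run_succ' (n a k : ℕ) : run n a (k + 1) = run n a k * x n (a + k) := by
  simp [run, List.range'_concat]

theorem commute_run {n a k : ℕ} {g : BraidGroup n}
    (h : ∀ j, a ≤ j → j < a + k → Commute g (x n j)) : Commute g (run n a k) := by
  apply Commute.list_prod_right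
  intro y hy
  simp only [List.mem_map, List.mem_range'_1] at hy
  obtain ⟨j, hj, rfl⟩ := hy
  exact h j hj.1 hj.2

/-- Letters of the run commute past `x_i` except at `i` and `i + 1`, where the braid relation raises
the index by one. -/
theorem run_mul_x {n : ℕ} (k a i : ℕ) (ha : 1 ≤ a) (hk : a + k ≤ n) (hai : a ≤ i)
    (hik : i + 1 < a + k) : run n a k * x n i = x n (i + 1) * run n a k := by
  induction k generalizing a with
  | zero => omega
  | succ k ih =>
    rcases Nat.eq_or_lt_of_le hai with rfl | h
    · obtain ⟨k, rfl⟩ : ∃ k', k = k' + 1 := ⟨k - 1, by omega⟩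
      rw [run_succ, run_succ]
      have hc : Commute (x n a) (run n (a + 1 + 1) k) :=
        commute_run fun j hj _ => x_comm n (by omega)
      have hb := x_braid (n := n) ha (by omega)
      calc _ = x n a * x n (a + 1) * (run n (a + 1 + 1) k * x n a) := by group
        _ = x n a * x n (a + 1) * x n a * run n (a + 1 + 1) k := by rw [← hc.eq]; group
        _ = _ := by rw [hb]; group
    · rw [run_succ, mul_assoc, ih (a + 1) (by omega) (by omega) h (by omega), ← mul_assoc,
        (x_comm n (show a + 2 ≤ i + 1 by omega)).eq, mul_assoc]

theorem run_pow_mul_x {n a k : ℕ} (ha : 1 ≤ a) (hk : a + k ≤ n) (b i : ℕ) (hai : a ≤ i)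
    (hik : i + b < a + k) : run n a k ^ b * x n i = x n (i + b) * run n a k ^ b := by
  induction b with
  | zero => simp
  | succ b ih =>
    rw [pow_succ', mul_assoc, ih (by omega), ← mul_assoc,
      run_mul_x k a (i + b) ha hk (by omega) (by omega), mul_assoc, ← add_assoc]

theorem run_pow_mul_run {n a k : ℕ} (ha : 1 ≤ a) (hk : a + k ≤ n) (b j : ℕ)
    (h : j + b ≤ k) : run n a k ^ b * run n a j = run n (a + b) j * run n a k ^ b := by
  induction j with
  | zero => simp [run]
  | succ j ih =>
    rw [run_succ', ← mul_assoc, ih (by omega), mul_assoc,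
      run_pow_mul_x ha hk b _ (by omega) (by omega), run_succ', mul_assoc]
    congr 3
    omega

/-- The index shift wraps around: the last generator returns to the first one after two conjugations
by the run, not one. -/
theorem run_sq_mul_x {n a k : ℕ} (ha : 1 ≤ a) (hk : a + (k + 1) ≤ n) :
    run n a (k + 1) ^ 2 * x n (a + k) = x n a * run n a (k + 1) ^ 2 := by
  have h1 : run n a (k + 1) * run n a k = run n (a + 1) k * run n a (k + 1) := by
    simpa using run_pow_mul_run ha hk 1 k (by omega)
  have h2 : run n a (k + 1) ^ 2 = run n (a + 1) k * run n a (k + 1) * x n (a + k) := by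
    rw [← h1, mul_assoc, ← run_succ', sq]
  calc _ = x n a * run n (a + 1) k * run n a (k + 1) * x n (a + k) := by rw [← run_succ, sq]
    _ = _ := by rw [h2]; group

/-- The full twist is central. -/
theorem run_pow_commute_x {n a k : ℕ} (ha : 1 ≤ a) (hk : a + k ≤ n) (i : ℕ) (hai : a ≤ i)
    (hik : i < a + k) : Commute (run n a k ^ (k + 1)) (x n i) := by
  obtain ⟨k, rfl⟩ : ∃ k', k = k' + 1 := ⟨k - 1, by omega⟩
  have h1 := run_pow_mul_x ha hk (a + k - i) i hai (by omega)
  have h2 := run_sq_mul_x ha hk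
  have h3 := run_pow_mul_x ha hk (i - a) a le_rfl (by omega)
  rw [show i + (a + k - i) = a + k by omega] at h1
  rw [show a + (i - a) = i by omega] at h3
  -- Going once around: `a + k - i` shifts carry `x_i` to the last generator, two conjugations wrap
  -- it to `x_a`, and `i - a` shifts bring it back.
  have he : k + 1 + 1 = (i - a) + 2 + (a + k - i) := by omega
  change _ * _ = _ * _
  rw [he, pow_add, mul_assoc, h1, pow_add, mul_assoc, ← mul_assoc (_ ^ 2), h2, mul_assoc (x n a),
    ← mul_assoc _ (x n a), h3]
  group

/-- The power `d ^ b` rotates the `a + b` strands by `b` places. The first block is shifted without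
wrapping; the second would wrap, so its image is found from the inverse shift by `d ^ a` and the
centrality of `d ^ (a + b)`. -/
theorem run_pow_conj_blocks {n s a b : ℕ} (ha : 1 ≤ a) (hb : 1 ≤ b) (h : s + (a + b) ≤ n) :
    run n (s + 1) (a + b - 1) ^ b * (run n (s + 1) (a - 1) * run n (s + a + 1) (b - 1)) =
      run n (s + 1) (b - 1) * run n (s + b + 1) (a - 1) * run n (s + 1) (a + b - 1) ^ b := by
  set d := run n (s + 1) (a + b - 1) with hd
  have h1 : d ^ b * run n (s + 1) (a - 1) = run n (s + b + 1) (a - 1) * d ^ b := by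
    have := run_pow_mul_run (n := n) (a := s + 1) (k := a + b - 1) (by omega) (by omega) b (a - 1)
      (by omega)
    rwa [show s + 1 + b = s + b + 1 by omega] at this
  have h2 : d ^ a * run n (s + 1) (b - 1) = run n (s + a + 1) (b - 1) * d ^ a := by
    have := run_pow_mul_run (n := n) (a := s + 1) (k := a + b - 1) (by omega) (by omega) a (b - 1)
      (by omega)
    rwa [show s + 1 + a = s + a + 1 by omega] at this
  have h3 : Commute (d ^ (a + b)) (run n (s + 1) (b - 1)) := by
    apply commute_run
    intro j hj hj'
    have := run_pow_commute_x (n := n) (a := s + 1) (k := a + b - 1) (by omega) (by omega) j hj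
      (by omega)
    rwa [show a + b - 1 + 1 = a + b by omega] at this
  have h4 : d ^ b * run n (s + a + 1) (b - 1) = run n (s + 1) (b - 1) * d ^ b := by
    apply mul_right_cancel (b := d ^ a)
    rw [mul_assoc, ← h2, ← mul_assoc, ← pow_add, add_comm b a, h3.eq, mul_assoc, ← pow_add,
      add_comm b a]
  have h5 : Commute (run n (s + b + 1) (a - 1)) (run n (s + 1) (b - 1)) := by
    apply commute_run
    intro j hj hj'
    apply Commute.symm
    apply commute_run
    intro i hi _
    exact x_comm n (by omega)
  rw [← mul_assoc, h1, mul_assoc, h4, ← mul_assoc, h5.eq]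

/-! ### Permuting the blocks -/

/-- The subgroup generated by the `x_j` with `lo < j < hi`. -/
def segment (n lo hi : ℕ) : Subgroup (BraidGroup n) :=
  Subgroup.closure (x n '' Set.Ioo lo hi)

theorem x_mem_segment {n lo hi j : ℕ} (h1 : lo < j) (h2 : j < hi) : x n j ∈ segment n lo hi :=
  Subgroup.subset_closure ⟨j, ⟨h1, h2⟩, rfl⟩

theorem segment_mono {n lo hi lo' hi' : ℕ} (h1 : lo' ≤ lo) (h2 : hi ≤ hi') :
    segment n lo hi ≤ segment n lo' hi' :=
  Subgroup.closure_mono (Set.image_mono (Set.Ioo_subset_Ioo h1 h2))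

theorem run_mem_segment {n a k lo hi : ℕ} (h1 : lo < a) (h2 : a + k ≤ hi) :
    run n a k ∈ segment n lo hi := by
  apply Subgroup.list_prod_mem
  intro y hy
  simp only [List.mem_map, List.mem_range'_1] at hy
  obtain ⟨j, hj, rfl⟩ := hy
  exact x_mem_segment (by omega) (by omega)

/-- The generator `x_mid` belongs to neither segment, so indices from the two sides differ by at
least two. -/
theorem segment_commute {n lo mid hi : ℕ} {g h : BraidGroup n} (hg : g ∈ segment n lo mid)
    (hh : h ∈ segment n mid hi) : Commute g h := by
  induction hg using Subgroup.closure_induction with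
  | mem y hy =>
    obtain ⟨i, hi, rfl⟩ := hy
    induction hh using Subgroup.closure_induction with
    | mem z hz =>
      obtain ⟨j, hj, rfl⟩ := hz
      exact x_comm n (by have := hi.2; have := hj.1; omega)
    | one => exact Commute.one_right _
    | mul _ _ _ _ h1 h2 => exact h1.mul_right h2
    | inv _ _ h1 => exact h1.inv_right
  | one => exact Commute.one_left _
  | mul _ _ _ _ h1 h2 => exact h1.mul_left h2
  | inv _ _ h1 => exact h1.inv_left

/-- The product of the blocks given by a list of block sizes, starting after strand `s`. -/
def blocks (n s : ℕ) (C : List ℕ) : BraidGroup n := ((canonicalWord s C).map (x n)).prod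

theorem blocks_cons (n s a : ℕ) (C : List ℕ) :
    blocks n s (a :: C) = run n (s + 1) (a - 1) * blocks n (s + a) C := by
  simp [blocks, canonicalWord, run]

theorem blocks_mem_segment {n : ℕ} (C : List ℕ) (s : ℕ) (hC : ∀ c ∈ C, 1 ≤ c) :
    blocks n s C ∈ segment n s (s + C.sum) := by
  induction C generalizing s with
  | nil => simp [blocks, canonicalWord]
  | cons a C ih =>
    have ha : 1 ≤ a := hC a (by simp)
    rw [blocks_cons, List.sum_cons]
    refine Subgroup.mul_mem _ (run_mem_segment (by omega) (by omega)) ?_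
    exact segment_mono (by omega) (by omega) (ih (s + a) fun c hc => hC c (by simp [hc]))

/-- Keeping the conjugator inside the segment occupied by the blocks is what lets the induction
proceed: it commutes with all blocks outside that segment. -/
theorem blocks_perm {n : ℕ} {C C' : List ℕ} (h : C.Perm C') (s : ℕ) (hC : ∀ c ∈ C, 1 ≤ c)
    (hn : s + C.sum ≤ n) :
    ∃ g ∈ segment n s (s + C.sum), g * blocks n s C = blocks n s C' * g := by
  induction h generalizing s with
  | nil => exact ⟨1, Subgroup.one_mem _, by simp⟩
  | @cons a C C' _ ih =>
    have ha : 1 ≤ a := hC a (by simp)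
    rw [List.sum_cons] at hn
    obtain ⟨g, hg, hgc⟩ := ih (s + a) (fun c hc => hC c (by simp [hc])) (by omega)
    refine ⟨g, segment_mono (by omega) (by simp; omega) hg, ?_⟩
    have hcom : Commute (run n (s + 1) (a - 1)) g :=
      segment_commute (run_mem_segment (lo := s) (hi := s + a) (by omega) (by omega)) hg
    rw [blocks_cons, blocks_cons, ← mul_assoc, ← hcom.eq, mul_assoc, hgc, mul_assoc]
  | swap a b C =>
    have ha : 1 ≤ a := hC a (by simp)
    have hb : 1 ≤ b := hC b (by simp)
    simp only [List.sum_cons] at hn ⊢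
    have key := run_pow_conj_blocks (n := n) (s := s) hb ha (by omega)
    have hmem : run n (s + 1) (b + a - 1) ^ a ∈ segment n s (s + (b + a)) :=
      Subgroup.pow_mem _ (run_mem_segment (by omega) (by omega)) _
    refine ⟨_, segment_mono le_rfl (by omega) hmem, ?_⟩
    have htail := blocks_mem_segment (n := n) C (s + (b + a)) fun c hc => hC c (by simp [hc])
    have hcom := segment_commute hmem htail
    simp only [blocks_cons]
    rw [show s + a + b = s + (b + a) by omega, show s + b + a = s + (b + a) by omega]
    rw [← mul_assoc (run n (s + 1) (b - 1)), ← mul_assoc, key, mul_assoc, hcom.eq]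
    simp only [mul_assoc]
  | @trans C1 C2 C3 h1 _ ih1 ih2 =>
    obtain ⟨g, hg, hgc⟩ := ih1 s hC hn
    obtain ⟨g', hg', hgc'⟩ := ih2 s (fun c hc => hC c (h1.mem_iff.2 hc)) (by rwa [← h1.sum_eq])
    rw [← h1.sum_eq] at hg'
    refine ⟨g' * g, Subgroup.mul_mem _ hg' hg, ?_⟩
    rw [mul_assoc, hgc, ← mul_assoc, hgc', mul_assoc]

/-! ### Rearranging a word without repetitions -/

theorem isConj_list_prod_append {G : Type*} [Group G] (u v : List G) :
    IsConj (u ++ v).prod (v ++ u).prod := by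
  rw [isConj_iff]
  exact ⟨u.prod⁻¹, by simp⟩

/-- If letters with non-adjacent indices commute, then the product of all letters does not depend
on their order, up to conjugation. -/
theorem isConj_prod_of_perm_range {G : Type*} [Group G] (m : ℕ) (f : ℕ → G)
    (hf : ∀ i j, i + 2 ≤ j → Commute (f i) (f j)) (w : List ℕ) (hw : w.Perm (List.range m)) :
    IsConj (w.map f).prod ((List.range m).map f).prod := by
  induction m generalizing f w with
  | zero => simp_all
  | succ m ih =>
    rcases m with _ | m
    · rw [List.range_succ, List.range_zero, List.nil_append, List.perm_singleton] at hw
      rw [hw]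
      exact IsConj.refl _
    have hmem : m ∈ w := hw.mem_iff.2 (by simp)
    obtain ⟨u, v, rfl⟩ := List.append_of_mem hmem
    have hp : (m :: (v ++ u)).Perm (List.range (m + 2)) := by
      refine List.Perm.trans ?_ hw
      exact (List.perm_append_comm (l₁ := m :: v) (l₂ := u))
    -- A cyclic rotation brings `m` to the front, so that `m + 1` stands somewhere to its right.
    have hc : IsConj ((u ++ m :: v).map f).prod ((m :: (v ++ u)).map f).prod := by
      have := isConj_list_prod_append (u.map f) ((m :: v).map f)
      simpa using this
    refine hc.trans ?_
    rw [List.range_succ, List.range_succ] at hp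
    have hmem' : m + 1 ∈ v ++ u := by
      have : m + 1 ∈ m :: (v ++ u) := hp.mem_iff.2 (by simp)
      simpa using this
    obtain ⟨p, q, hpq⟩ := List.append_of_mem hmem'
    rw [hpq] at hp ⊢
    have hp2 : (m :: (p ++ q)).Perm (List.range (m + 1)) := by
      have h1 : ((m + 1) :: m :: (p ++ q)).Perm ((m + 1) :: List.range (m + 1)) := by
        rw [List.range_succ]
        refine List.Perm.trans ?_ (hp.trans ?_)
        · refine (List.Perm.swap _ _ _).trans (List.Perm.cons _ ?_)
          exact List.perm_middle.symm
        · exact List.perm_append_singleton _ _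
      exact h1.cons_inv
    have hnd : (m :: (p ++ q)).Nodup := hp2.nodup_iff.2 List.nodup_range
    have hlt : ∀ j ∈ p ++ q, j < m := by
      intro j hj
      have h1 : j ∈ List.range (m + 1) := hp2.mem_iff.1 (by simp only [List.mem_cons]; exact Or.inr hj)
      have h2 : j ≠ m := by
        rintro rfl
        exact (List.nodup_cons.1 hnd).1 hj
      rw [List.mem_range] at h1
      omega
    -- Only letters below `m` separate `m` from `m + 1`, and they commute with `f (m + 1)`. The two
    -- top letters can thus be merged into one, which shortens the path by a vertex.
    let f' : ℕ → G := fun j => if j < m then f j else if j = m then f m * f (m + 1) else 1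
    have hf'm : f' m = f m * f (m + 1) := by simp [f']
    have hf'j : ∀ j, j < m → f' j = f j := fun j hj => if_pos hj
    have hcomm : ∀ i j, i + 2 ≤ j → Commute (f' i) (f' j) := by
      intro i j hij
      rcases lt_trichotomy j m with hj | rfl | hj
      · rw [hf'j j hj, hf'j i (by omega)]
        exact hf i j hij
      · rw [hf'm, hf'j i (by omega)]
        exact (hf _ _ hij).mul_right (hf _ _ (by omega))
      · have : f' j = 1 := by
          simp only [f']; rw [if_neg (by omega), if_neg (by omega)]
        rw [this]
        exact Commute.one_right _
    have key := ih f' hcomm _ hp2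
    have e1 : ((m :: (p ++ q)).map f').prod = ((m :: (p ++ (m + 1) :: q)).map f).prod := by
      have hP : p.map f' = p.map f :=
        List.map_congr_left fun j hj => hf'j j (hlt j (by simp [hj]))
      have hQ : q.map f' = q.map f :=
        List.map_congr_left fun j hj => hf'j j (hlt j (by simp [hj]))
      have hcP : Commute (f (m + 1)) (p.map f).prod := by
        apply Commute.list_prod_right
        intro y hy
        obtain ⟨j, hj, rfl⟩ := List.mem_map.1 hy
        have := hlt j (by simp [hj])
        exact (hf j (m + 1) (by omega)).symm
      simp only [List.map_cons, List.map_append, List.prod_cons, List.prod_append, hP, hQ, hf'm]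
      rw [mul_assoc, ← mul_assoc (f (m + 1)), hcP.eq, mul_assoc]
    have e2 : ((List.range (m + 1)).map f').prod = ((List.range (m + 1 + 1)).map f).prod := by
      have hR : (List.range m).map f' = (List.range m).map f :=
        List.map_congr_left fun j hj => hf'j j (List.mem_range.1 hj)
      rw [List.range_succ, List.range_succ, List.range_succ]
      simp only [List.map_append, List.prod_append, hR, List.map_cons, List.map_nil,
        List.prod_singleton, hf'm, mul_assoc]
    rwa [e1, e2] at key

theorem isConj_prod_of_perm_sorted {n : ℕ} (w l : List ℕ) (hl : l.Pairwise (· < ·))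
    (hw : w.Perm l) : IsConj (w.map (x n)).prod (l.map (x n)).prod := by
  -- Letters are renamed by their rank in `l`. Since `l` is strictly increasing, ranks at distance
  -- two belong to indices at distance at least two.
  let f : ℕ → BraidGroup n := fun j => if h : j < l.length then x n l[j] else 1
  have hf : ∀ i j, i + 2 ≤ j → Commute (f i) (f j) := by
    intro i j hij
    by_cases hj : j < l.length
    · have hi : i < l.length := by omega
      simp only [f, dif_pos hi, dif_pos hj]
      apply x_comm
      have h1 : l[i] < l[i + 1] := List.pairwise_iff_getElem.1 hl i (i + 1) hi (by omega) (by omega)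
      have h2 : l[i + 1] < l[j] :=
        List.pairwise_iff_getElem.1 hl (i + 1) j (by omega) hj (by omega)
      omega
    · simp only [f, dif_neg hj]
      exact Commute.one_right _
  have hinj : l.Nodup := hl.imp (fun h => h.ne)
  have hfi : ∀ y ∈ l, f (l.idxOf y) = x n y := by
    intro y hy
    have : l.idxOf y < l.length := List.idxOf_lt_length_iff.2 hy
    simp only [f, dif_pos this, List.getElem_idxOf]
  have hlr : l.map l.idxOf = List.range l.length := by
    apply List.ext_getElem
    · simp
    · intro i h1 h2
      simp [hinj.idxOf_getElem]
  have key := isConj_prod_of_perm_range l.length f hf (w.map l.idxOf) (by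
    rw [← hlr]; exact hw.map _)
  rw [← hlr, List.map_map, List.map_map] at key
  have e1 : w.map (f ∘ l.idxOf) = w.map (x n) :=
    List.map_congr_left fun y hy => hfi y (hw.mem_iff.1 hy)
  have e2 : l.map (f ∘ l.idxOf) = l.map (x n) := List.map_congr_left fun y hy => hfi y hy
  rwa [e1, e2] at key

/-- Each strand in turn is glued to the block after it if `x_{s+1}` occurs, and otherwise becomes a
block of size `1`. Such blocks contribute the empty word but keep the sizes summing to `t`. -/
theorem exists_blocks_of_sorted (t : ℕ) (s : ℕ) (l : List ℕ) (hl : l.Pairwise (· < ·))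
    (hs : ∀ y ∈ l, s < y ∧ y < s + t) :
    ∃ C : List ℕ, (∀ c ∈ C, 1 ≤ c) ∧ C.sum = t ∧ canonicalWord s C = l := by
  induction t generalizing s l with
  | zero =>
    obtain rfl : l = [] := List.eq_nil_iff_forall_not_mem.2 fun y hy => by
      have := hs y hy; omega
    exact ⟨[], by simp, rfl, rfl⟩
  | succ t ih =>
    by_cases h : s + 1 ∈ l
    · obtain ⟨l', rfl⟩ : ∃ l', l = (s + 1) :: l' := by
        rcases l with _ | ⟨y, l'⟩
        · simp at h
        · refine ⟨l', ?_⟩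
          have hy := hs y (by simp)
          rcases List.mem_cons.1 h with h | h
          · rw [h]
          · have := (List.pairwise_cons.1 hl).1 _ h
            omega
      rw [List.pairwise_cons] at hl
      have h0 := hs (s + 1) (by simp)
      obtain ⟨C, hC, hsum, hword⟩ := ih (s + 1) l' hl.2 fun y hy =>
        ⟨hl.1 y hy, by have := hs y (by simp [hy]); omega⟩
      rcases C with _ | ⟨c, C⟩
      · simp at hsum; omega
      · refine ⟨(c + 1) :: C, ?_, ?_, ?_⟩
        · intro d hd
          rcases List.mem_cons.1 hd with rfl | hd
          · omega
          · exact hC d (by simp [hd])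
        · simp at hsum ⊢; omega
        · obtain ⟨c, rfl⟩ : ∃ c', c = c' + 1 := ⟨c - 1, by have := hC c (by simp); omega⟩
          rw [← hword]
          simp [canonicalWord, List.range'_succ]
          rw [show s + 1 + (c + 1) = s + (c + 1 + 1) by omega]
    · obtain ⟨C, hC, hsum, hword⟩ := ih (s + 1) l hl fun y hy => by
        have h1 := hs y hy
        have : y ≠ s + 1 := by rintro rfl; exact h hy
        omega
      refine ⟨1 :: C, ?_, ?_, ?_⟩
      · intro d hd
        rcases List.mem_cons.1 hd with rfl | hd
        · omega
        · exact hC d hd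
      · simp; omega
      · simpa [canonicalWord] using hword

theorem canonicalWord_append_ones (A : List ℕ) (s k : ℕ) :
    canonicalWord s (A ++ List.replicate k 1) = canonicalWord s A := by
  induction A generalizing s with
  | nil =>
    induction k generalizing s with
    | zero => rfl
    | succ k ih => simpa [List.replicate_succ, canonicalWord] using ih (s + 1)
  | cons a A ih => simp [canonicalWord, ih]

theorem exists_sorted_parts (C : List ℕ) (hC : ∀ c ∈ C, 1 ≤ c) :
    ∃ (A : List ℕ) (k : ℕ), A.Pairwise (fun a b => a ≥ b) ∧ (∀ a ∈ A, 2 ≤ a) ∧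
      C.Perm (A ++ List.replicate k 1) := by
  let B := C.filter (fun c => 2 ≤ c)
  let D := C.filter (fun c => !decide (2 ≤ c))
  have hD : D = List.replicate D.length 1 := by
    apply List.eq_replicate_of_mem
    intro d hd
    have h := List.mem_filter.1 hd
    have h1 := hC d h.1
    have h2 : ¬ 2 ≤ d := by simpa using h.2
    omega
  refine ⟨B.insertionSort (fun a b => a ≥ b), D.length, List.pairwise_insertionSort _ _, ?_, ?_⟩
  · intro a ha
    have := (List.perm_insertionSort (fun a b => a ≥ b) B).mem_iff.1 ha
    simpa using (List.mem_filter.1 this).2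
  · rw [← hD]
    refine (List.filter_append_perm (fun c => decide (2 ≤ c)) C).symm.trans ?_
    exact (List.perm_insertionSort _ B).symm.append_right D

theorem IsSimple.exists_isConj {n : ℕ} {β : BraidGroup n} (h : IsSimple β) :
    ∃ A : List ℕ, A.Pairwise (fun a b => a ≥ b) ∧ (∀ a ∈ A, 2 ≤ a) ∧ A.sum ≤ n ∧
      IsConj β (canonicalBraid n A) := by
  obtain ⟨w, hw, rfl⟩ := h
  rw [map_gen_prod]
  set u := w.map Subtype.val with hu
  have hund : u.Nodup := hw.map Subtype.val_injective
  have hur : ∀ y ∈ u, 0 < y ∧ y < 0 + n := by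
    intro y hy
    obtain ⟨i, _, rfl⟩ := List.mem_map.1 hy
    have := i.2
    omega
  let l := u.insertionSort (· ≤ ·)
  have hlp : l.Perm u := List.perm_insertionSort _ _
  have hls : l.Pairwise (· < ·) :=
    ((List.pairwise_insertionSort (· ≤ ·) u).and (hlp.nodup_iff.2 hund)).imp
      fun h => lt_of_le_of_ne h.1 h.2
  obtain ⟨C, hC, hsum, hword⟩ := exists_blocks_of_sorted n 0 l hls fun y hy =>
    hur y (hlp.mem_iff.1 hy)
  obtain ⟨A, k, hA, hA2, hp⟩ := exists_sorted_parts C hC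
  refine ⟨A, hA, hA2, ?_, ?_⟩
  · have := hp.sum_eq
    simp at this
    omega
  · refine (isConj_prod_of_perm_sorted u l hls hlp.symm).trans ?_
    obtain ⟨g, _, hg⟩ := blocks_perm (n := n) hp 0 hC (by omega)
    rw [blocks, blocks, canonicalWord_append_ones, hword] at hg
    rw [isConj_iff]
    exact ⟨g, by rw [hg, mul_inv_cancel_right]; rfl⟩

/-! ### The underlying permutation -/

/-- The position `i - 1` (counted from `0`), the left one of the strands crossed by `x_i`. -/
def leftPos {n : ℕ} (i : ArtinIndex n) : Fin n := ⟨i.1 - 1, by have := i.2; omega⟩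

/-- The position `i` (counted from `0`), the right one of the strands crossed by `x_i`. -/
def rightPos {n : ℕ} (i : ArtinIndex n) : Fin n := ⟨i.1, i.2.2⟩

theorem leftPos_ne_rightPos {n : ℕ} (i : ArtinIndex n) : leftPos i ≠ rightPos i := by
  intro h
  have h1 : i.1 - 1 = i.1 := congrArg Fin.val h
  have := i.2
  omega

/-- The transposition of the strands crossed by `x_i`. -/
def transp {n : ℕ} (i : ArtinIndex n) : Equiv.Perm (Fin n) :=
  Equiv.swap (leftPos i) (rightPos i)

theorem far_positions {n : ℕ} {i j : ArtinIndex n} (h : i.1 + 2 ≤ j.1) :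
    leftPos i ≠ leftPos j ∧ leftPos i ≠ rightPos j ∧ rightPos i ≠ leftPos j ∧
      rightPos i ≠ rightPos j := by
  have hi := i.2
  have hj := j.2
  refine ⟨?_, ?_, ?_, ?_⟩ <;> intro h' <;> have h1 := congrArg Fin.val h' <;>
    simp only [leftPos, rightPos] at h1 <;> omega

theorem rightPos_eq_leftPos {n : ℕ} {i j : ArtinIndex n} (h : j.1 = i.1 + 1) :
    rightPos i = leftPos j := by
  apply Fin.ext
  simp only [leftPos, rightPos]
  omega

theorem leftPos_ne_of_adjacent {n : ℕ} {i j : ArtinIndex n} (h : j.1 = i.1 + 1) :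
    leftPos i ≠ rightPos j := by
  intro h'
  have h1 := congrArg Fin.val h'
  simp only [leftPos, rightPos] at h1
  omega

theorem transp_comm {n : ℕ} {i j : ArtinIndex n} (h : i.1 + 2 ≤ j.1) :
    transp i * transp j = transp j * transp i := by
  obtain ⟨h1, h2, h3, h4⟩ := far_positions h
  exact (Equiv.Perm.Disjoint.commute (Equiv.Perm.disjoint_swap_swap (by
    have h5 := leftPos_ne_rightPos i
    have h6 := leftPos_ne_rightPos j
    simp [h1, h2, h3, h4, h5, h6]))).eq

theorem transp_braid {n : ℕ} {i j : ArtinIndex n} (h : j.1 = i.1 + 1) :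
    transp i * transp j * transp i = transp j * transp i * transp j := by
  have h1 := leftPos_ne_rightPos i
  have h2 := leftPos_ne_rightPos j
  have h3 := leftPos_ne_of_adjacent h
  unfold transp
  rw [rightPos_eq_leftPos h] at *
  rw [Equiv.swap_mul_swap_mul_swap h1 h3, Equiv.swap_comm (leftPos i) (leftPos j),
    Equiv.swap_comm (leftPos j) (rightPos j),
    Equiv.swap_mul_swap_mul_swap h2.symm h3.symm, Equiv.swap_comm]

theorem transp_inv {n : ℕ} (i : ArtinIndex n) : (transp i)⁻¹ = transp i := Equiv.swap_inv _ _

theorem transp_left {n : ℕ} (i : ArtinIndex n) : transp i (leftPos i) = rightPos i :=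
  Equiv.swap_apply_left _ _

theorem transp_right {n : ℕ} (i : ArtinIndex n) : transp i (rightPos i) = leftPos i :=
  Equiv.swap_apply_right _ _

theorem transp_of_ne {n : ℕ} {i : ArtinIndex n} {j : Fin n} (h1 : j ≠ leftPos i)
    (h2 : j ≠ rightPos i) : transp i j = j :=
  Equiv.swap_apply_of_ne_of_ne h1 h2

/-- The permutation underlying a braid. -/
def permHom (n : ℕ) : BraidGroup n →* Equiv.Perm (Fin n) :=
  PresentedGroup.toGroup (f := transp) (by
    rintro r (⟨i, j, h, rfl⟩ | ⟨i, j, h, rfl⟩)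
    · simp only [map_mul, map_inv, FreeGroup.lift_apply_of]
      rw [mul_inv_eq_one, transp_comm h]
    · simp only [map_mul, map_inv, FreeGroup.lift_apply_of]
      rw [mul_inv_eq_one, transp_braid h])

theorem permHom_gen {n : ℕ} (i : ArtinIndex n) : permHom n (gen i) = transp i :=
  PresentedGroup.toGroup.of _

/-- Rational labellings of the strands that are preserved by a permutation. -/
def fixedLabels {n : ℕ} (σ : Equiv.Perm (Fin n)) : Submodule ℚ (Fin n → ℚ) where
  carrier := {v | v ∘ σ = v}
  add_mem' := by
    intro v w hv hw
    funext j
    have h1 := congrFun hv j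
    have h2 := congrFun hw j
    simp_all
  zero_mem' := rfl
  smul_mem' := by
    intro c v hv
    funext j
    have h1 := congrFun hv j
    simp_all

theorem mem_fixedLabels {n : ℕ} {σ : Equiv.Perm (Fin n)} {v : Fin n → ℚ} :
    v ∈ fixedLabels σ ↔ v ∘ σ = v := Iff.rfl

/-- The dimension stands for the number of cycles, as invariant labellings are those constant on
cycles. -/
theorem finrank_fixedLabels_conj {n : ℕ} (σ τ : Equiv.Perm (Fin n)) :
    Module.finrank ℚ (fixedLabels (τ * σ * τ⁻¹)) = Module.finrank ℚ (fixedLabels σ) := by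
  have h : fixedLabels σ =
      (fixedLabels (τ * σ * τ⁻¹)).map (LinearEquiv.funCongrLeft ℚ ℚ τ).toLinearMap := by
    ext v
    simp only [Submodule.mem_map, mem_fixedLabels]
    constructor
    · intro hv
      refine ⟨v ∘ ⇑τ⁻¹, ?_, ?_⟩
      · funext j
        have := congrFun hv (τ⁻¹ j)
        simpa using this
      · funext j
        simp [LinearEquiv.funCongrLeft_apply, LinearMap.funLeft]
    · rintro ⟨u, hu, rfl⟩
      funext j
      have := congrFun hu (τ j)
      simpa [LinearEquiv.funCongrLeft_apply, LinearMap.funLeft] using this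
  rw [h]
  exact (LinearEquiv.finrank_map_eq (LinearEquiv.funCongrLeft ℚ ℚ τ) _).symm

/-- The differences of the labels at the crossings `x_i`, for `i` in a finite set. -/
def labelDiff {n : ℕ} (S : Finset (ArtinIndex n)) : (Fin n → ℚ) →ₗ[ℚ] (S → ℚ) :=
  LinearMap.pi fun i =>
    (LinearMap.proj (rightPos i.1) : (Fin n → ℚ) →ₗ[ℚ] ℚ) - LinearMap.proj (leftPos i.1)

theorem labelDiff_apply {n : ℕ} (S : Finset (ArtinIndex n)) (v : Fin n → ℚ) (i : S) :
    labelDiff S v i = v (rightPos i.1) - v (leftPos i.1) := rfl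

theorem labelDiff_surjective {n : ℕ} (S : Finset (ArtinIndex n)) :
    Function.Surjective (labelDiff S) := by
  intro c
  let d : ℕ → ℚ := fun k => if h : ∃ hk : 1 ≤ k ∧ k < n, (⟨k, hk⟩ : ArtinIndex n) ∈ S then
    c ⟨⟨k, h.1⟩, h.2⟩ else 0
  -- Prescribed differences are realized by partial sums, with difference `0` at crossings outside
  -- `S`.
  refine ⟨fun j => ∑ k ∈ Finset.range (j.1 + 1), d k, ?_⟩
  funext i
  obtain ⟨⟨k, hk⟩, hi⟩ := i
  rw [labelDiff_apply]
  simp only [leftPos, rightPos]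
  rw [Nat.sub_add_cancel hk.1, Finset.sum_range_succ, add_sub_cancel_left]
  exact dif_pos ⟨hk, hi⟩

theorem finrank_ker_labelDiff {n : ℕ} (S : Finset (ArtinIndex n)) :
    Module.finrank ℚ (LinearMap.ker (labelDiff S)) + S.card = n := by
  have h := LinearMap.finrank_range_add_finrank_ker (labelDiff S)
  rw [LinearMap.range_eq_top.2 (labelDiff_surjective S), finrank_top] at h
  simp at h
  omega

theorem comp_transp {n : ℕ} {i : ArtinIndex n} {v : Fin n → ℚ} :
    v ∘ transp i = v ↔ v (rightPos i) = v (leftPos i) := by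
  constructor
  · intro h
    have := congrFun h (leftPos i)
    simpa [transp] using this
  · intro h
    funext j
    simp only [Function.comp_apply, transp]
    rcases eq_or_ne j (leftPos i) with rfl | h1
    · rw [Equiv.swap_apply_left, h]
    · rcases eq_or_ne j (rightPos i) with rfl | h2
      · rw [Equiv.swap_apply_right, h]
      · rw [Equiv.swap_apply_of_ne_of_ne h1 h2]

theorem mem_ker_labelDiff {n : ℕ} {S : Finset (ArtinIndex n)} {v : Fin n → ℚ} :
    v ∈ LinearMap.ker (labelDiff S) ↔ ∀ i ∈ S, v ∘ transp i = v := by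
  simp only [LinearMap.mem_ker, funext_iff (f := labelDiff S v), comp_transp, Subtype.forall]
  refine forall_congr' fun i => forall_congr' fun hi => forall_congr' fun h => ?_
  rw [labelDiff_apply]
  simp [sub_eq_zero]

theorem ker_labelDiff_le {n : ℕ} (w : List (ArtinIndex n)) :
    LinearMap.ker (labelDiff w.toFinset) ≤ fixedLabels (permHom n (w.map gen).prod) := by
  intro v hv
  rw [mem_ker_labelDiff] at hv
  simp only [List.mem_toFinset] at hv
  rw [mem_fixedLabels]
  induction w with
  | nil => simp
  | cons i w ih =>
    simp only [List.map_cons, List.prod_cons, map_mul, permHom_gen, Equiv.Perm.coe_mul]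
    rw [← Function.comp_assoc, hv i (by simp)]
    exact ih fun j hj => hv j (by simp [hj])

/-- The sum of the labels of the strands to the left of the crossing `x_i`. -/
def leftSum {n : ℕ} (i : ArtinIndex n) (v : Fin n → ℚ) : ℚ :=
  ∑ j : Fin n, if j.1 < i.1 then v j else 0

theorem leftSum_comp {n : ℕ} (i : ArtinIndex n) (v : Fin n → ℚ) (σ : Equiv.Perm (Fin n)) :
    leftSum i (v ∘ σ) = ∑ j : Fin n, if (σ⁻¹ j).1 < i.1 then v j else 0 := by
  unfold leftSum
  rw [← Equiv.sum_comp σ fun j => if (σ⁻¹ j).1 < i.1 then v j else 0]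
  simp

theorem leftSum_comp_transp_of_ne {n : ℕ} {i k : ArtinIndex n} (h : k ≠ i) (v : Fin n → ℚ) :
    leftSum i (v ∘ transp k) = leftSum i v := by
  rw [leftSum_comp, leftSum]
  refine Finset.sum_congr rfl fun j _ => ?_
  have hk := k.2
  have hne : k.1 ≠ i.1 := fun h' => h (Subtype.ext h')
  congr 1
  simp only [transp, Equiv.swap_inv, eq_iff_iff]
  rcases eq_or_ne j (leftPos k) with rfl | h1
  · rw [Equiv.swap_apply_left]; simp only [leftPos, rightPos]; omega
  · rcases eq_or_ne j (rightPos k) with rfl | h2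
    · rw [Equiv.swap_apply_right]; simp only [leftPos, rightPos]; omega
    · rw [Equiv.swap_apply_of_ne_of_ne h1 h2]

theorem leftSum_comp_transp_self {n : ℕ} (i : ArtinIndex n) (v : Fin n → ℚ) :
    leftSum i (v ∘ transp i) = leftSum i v + v (rightPos i) - v (leftPos i) := by
  have hi := i.2
  have h : ∀ j : Fin n, (if ((transp i)⁻¹ j).1 < i.1 then v j else 0) =
      (if j.1 < i.1 then v j else 0) + (if j = rightPos i then v j else 0)
        - (if j = leftPos i then v j else 0) := by
    intro j
    have hlr := leftPos_ne_rightPos i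
    rw [transp_inv]
    rcases eq_or_ne j (leftPos i) with rfl | h1
    · rw [transp_left, if_neg (by simp [rightPos]), if_pos (by simp [leftPos]; omega),
        if_neg hlr, if_pos rfl]
      ring
    · rcases eq_or_ne j (rightPos i) with rfl | h2
      · rw [transp_right, if_pos (by simp [leftPos]; omega),
          if_neg (by simp [rightPos]), if_pos rfl, if_neg hlr.symm]
        ring
      · rw [transp_of_ne h1 h2, if_neg h2, if_neg h1]
        ring
  rw [leftSum_comp, Finset.sum_congr rfl fun j _ => h j, Finset.sum_sub_distrib,
    Finset.sum_add_distrib]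
  simp [leftSum]

/-- A word avoiding `x_i` never moves a strand across that crossing, so it permutes the first `i`
positions among themselves. -/
theorem leftSum_comp_word {n : ℕ} {i : ArtinIndex n} (w : List (ArtinIndex n)) (hi : i ∉ w)
    (v : Fin n → ℚ) : leftSum i (v ∘ permHom n (w.map gen).prod) = leftSum i v := by
  induction w generalizing v with
  | nil => simp
  | cons k w ih =>
    simp only [List.mem_cons, not_or] at hi
    simp only [List.map_cons, List.prod_cons, map_mul, permHom_gen, Equiv.Perm.coe_mul]
    rw [← Function.comp_assoc, ih hi.2, leftSum_comp_transp_of_ne (Ne.symm hi.1)]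

/-- The first letter `x_i` changes the left sum by the label difference at `i`, and the remaining
word, which avoids `x_i`, cannot undo the change. Invariance thus forces the difference to vanish,
and the letter can be dropped. -/
theorem fixedLabels_eq_ker_of_nodup {n : ℕ} (w : List (ArtinIndex n)) (hw : w.Nodup) :
    fixedLabels (permHom n (w.map gen).prod) = LinearMap.ker (labelDiff w.toFinset) := by
  refine le_antisymm ?_ (ker_labelDiff_le w)
  intro v hv
  rw [mem_fixedLabels] at hv
  rw [mem_ker_labelDiff]
  simp only [List.mem_toFinset]
  induction w with
  | nil => simp
  | cons i w ih =>
    rw [List.nodup_cons] at hw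
    simp only [List.map_cons, List.prod_cons, map_mul, permHom_gen, Equiv.Perm.coe_mul] at hv
    rw [← Function.comp_assoc] at hv
    have h1 := leftSum_comp_word w hw.1 (v ∘ transp i)
    rw [hv, leftSum_comp_transp_self] at h1
    have h2 : v ∘ transp i = v := comp_transp.2 (by linarith)
    rw [h2] at hv
    intro j hj
    rcases List.mem_cons.1 hj with rfl | hj
    · exact h2
    · exact ih hw.2 hv j hj

/-! ### Degree, and simplicity under conjugation -/

theorem degreeHom_gen {n : ℕ} (i : ArtinIndex n) :
    degreeHom n (gen i) = Multiplicative.ofAdd 1 := PresentedGroup.toGroup.of _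

theorem degree_mul {n : ℕ} (α β : BraidGroup n) : degree (α * β) = degree α + degree β := by
  simp [degree]

theorem degree_gen {n : ℕ} (i : ArtinIndex n) : degree (gen i) = 1 := by
  simp [degree, degreeHom_gen]

theorem degree_word {n : ℕ} (w : List (ArtinIndex n)) :
    degree (w.map gen).prod = w.length := by
  induction w with
  | nil => simp [degree]
  | cons i w ih =>
    rw [List.map_cons, List.prod_cons, degree_mul, ih, degree_gen]
    simp [add_comm]

theorem degree_eq_of_isConj {n : ℕ} {α β : BraidGroup n} (h : IsConj α β) :
    degree α = degree β := by
  obtain ⟨c, rfl⟩ := isConj_iff.1 h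
  simp [degree]

theorem exists_word_of_mem_positiveBraids {n : ℕ} {β : BraidGroup n}
    (h : β ∈ positiveBraids n) : ∃ w : List (ArtinIndex n), (w.map gen).prod = β := by
  obtain ⟨l, hl, rfl⟩ := Submonoid.exists_list_of_mem_closure h
  clear h
  induction l with
  | nil => exact ⟨[], rfl⟩
  | cons y l ih =>
    obtain ⟨i, rfl⟩ := hl y (by simp)
    obtain ⟨w, hw⟩ := ih fun z hz => hl z (by simp [hz])
    exact ⟨i :: w, by simp [hw]⟩

/-- A positive braid conjugate to a simple braid is simple. -/
theorem IsSimple.of_isConj {n : ℕ} {β γ : BraidGroup n} (hβ : β ∈ positiveBraids n)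
    (hγ : IsSimple γ) (h : IsConj β γ) : IsSimple β := by
  obtain ⟨w, rfl⟩ := exists_word_of_mem_positiveBraids hβ
  obtain ⟨u, hu, rfl⟩ := hγ
  refine ⟨w, ?_, rfl⟩
  have hdeg := degree_eq_of_isConj h
  rw [degree_word, degree_word, Nat.cast_inj] at hdeg
  have h1 := finrank_ker_labelDiff w.toFinset
  have h2 := finrank_ker_labelDiff u.toFinset
  have h3 := Submodule.finrank_mono (ker_labelDiff_le w)
  obtain ⟨c, hc⟩ := isConj_iff.1 h
  have h4 : Module.finrank ℚ (fixedLabels (permHom n (w.map gen).prod)) =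
      Module.finrank ℚ (LinearMap.ker (labelDiff u.toFinset)) := by
    rw [← fixedLabels_eq_ker_of_nodup u hu, ← hc, map_mul, map_mul, map_inv,
      finrank_fixedLabels_conj]
  rw [List.toFinset_card_of_nodup hu] at h2
  -- With `h1`–`h4`: `n` minus the number of distinct letters of `w` is at most `n` minus the length
  -- of `u`, which is the length of `w`; so the letters of `w` are all distinct.
  have h5 := w.toFinset_card_le
  exact Multiset.coe_nodup.1 (Multiset.toFinset_card_eq_card_iff_nodup.1
    (show (w : Multiset (ArtinIndex n)).toFinset.card = w.length from (by
      change w.toFinset.card = _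
      omega)))

/-! ### Canonical braids are simple -/

theorem canonicalWord_bounds (A : List ℕ) (s : ℕ) (hA : ∀ a ∈ A, 1 ≤ a) :
    ∀ y ∈ canonicalWord s A, s < y ∧ y < s + A.sum := by
  induction A generalizing s with
  | nil => simp [canonicalWord]
  | cons a A ih =>
    intro y hy
    have ha := hA a (by simp)
    simp only [canonicalWord, List.mem_append, List.mem_range'_1] at hy
    rw [List.sum_cons]
    rcases hy with hy | hy
    · omega
    · have := ih (s + a) (fun c hc => hA c (by simp [hc])) y hy
      omega

theorem canonicalWord_sorted (A : List ℕ) (s : ℕ) (hA : ∀ a ∈ A, 1 ≤ a) :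
    (canonicalWord s A).Pairwise (· < ·) := by
  induction A generalizing s with
  | nil => simp [canonicalWord]
  | cons a A ih =>
    have hA' : ∀ c ∈ A, 1 ≤ c := fun c hc => hA c (by simp [hc])
    rw [canonicalWord, List.pairwise_append]
    refine ⟨List.pairwise_lt_range', ih _ hA', ?_⟩
    intro y hy z hz
    have h1 := canonicalWord_bounds A (s + a) hA' z hz
    have ha := hA a (by simp)
    rw [List.mem_range'_1] at hy
    omega

theorem canonicalWord_length (A : List ℕ) (s : ℕ) (hA : ∀ a ∈ A, 1 ≤ a) :
    (canonicalWord s A).length + A.length = A.sum := by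
  induction A generalizing s with
  | nil => simp [canonicalWord]
  | cons a A ih =>
    have ha := hA a (by simp)
    have := ih (s + a) fun c hc => hA c (by simp [hc])
    simp [canonicalWord]
    omega

/-- The word of a canonical braid, as a list of generators. -/
theorem exists_word_canonicalBraid {n : ℕ} (A : List ℕ) (hA : ∀ a ∈ A, 1 ≤ a)
    (hn : A.sum ≤ n) : ∃ w : List (ArtinIndex n), w.Nodup ∧ w.length + A.length = A.sum ∧
      (w.map gen).prod = canonicalBraid n A := by
  have hb : ∀ y ∈ canonicalWord 0 A, 1 ≤ y ∧ y < n := fun y hy => by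
    have := canonicalWord_bounds A 0 hA y hy
    omega
  refine ⟨(canonicalWord 0 A).attachWith _ hb, ?_, ?_, ?_⟩
  · apply List.Nodup.of_map Subtype.val
    rw [List.attachWith_map_subtype_val]
    exact (canonicalWord_sorted A 0 hA).imp fun h => h.ne
  · rw [List.length_attachWith]
    exact canonicalWord_length A 0 hA
  · rw [map_gen_prod, List.attachWith_map_subtype_val]
    rfl

theorem isSimple_canonicalBraid {n : ℕ} (A : List ℕ) (hA : ∀ a ∈ A, 1 ≤ a) (hn : A.sum ≤ n) :
    IsSimple (canonicalBraid n A) := by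
  obtain ⟨w, hw, _, h⟩ := exists_word_canonicalBraid A hA hn
  exact ⟨w, hw, h⟩

/-! ### Reduction of braids by the skein relation -/

theorem incl_gen {n : ℕ} (i : ArtinIndex n) :
    incl n (gen i) = gen (⟨i.1, i.2.1, Nat.lt_succ_of_lt i.2.2⟩ : ArtinIndex (n + 1)) :=
  PresentedGroup.toGroup.of _

theorem incl_x {n i : ℕ} (h : i < n) : incl n (x n i) = x (n + 1) i := by
  by_cases hi : 1 ≤ i
  · rw [x_eq_gen ⟨hi, h⟩, incl_gen, x_eq_gen]
  · rw [x, x, dif_neg (by omega), dif_neg (by omega), map_one]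

theorem incl_incl_commute_x {n : ℕ} (c : BraidGroup n) :
    Commute (incl (n + 1) (incl n c)) (x (n + 2) (n + 1)) := by
  have hc : c ∈ Subgroup.closure (Set.range (gen (n := n))) := by
    rw [closure_range_gen]; exact Subgroup.mem_top c
  induction hc using Subgroup.closure_induction with
  | mem y hy =>
    obtain ⟨i, rfl⟩ := hy
    have hi := i.2
    rw [← x_val, incl_x hi.2, incl_x (by omega)]
    exact x_comm _ (by omega)
  | one => simp
  | mul _ _ _ _ h1 h2 => rw [map_mul, map_mul]; exact h1.mul_left h2
  | inv _ _ h1 => rw [map_inv, map_inv]; exact h1.inv_left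

section Skein

variable {R M : Type*} [CommRing R] [AddCommGroup M] [Module R M]

/-- The skein relation, with coefficients `l`, `l'`, `m`, for a function on braids. -/
def IsSkeinFun (l l' m : R) {n : ℕ} (f : BraidGroup n → M) : Prop :=
  ∀ (α γ : BraidGroup n) (i : ArtinIndex n),
    l • f (α * (gen i)⁻¹ * γ) + l' • f (α * gen i * γ) + m • f (α * γ) = 0

/-- The skein relation, with coefficients `l`, `l'`, `m`, for a function on links. -/
def IsSkeinInvariant (l l' m : R) (Q : OrientedLink → M) : Prop :=
  ∀ Lp Lm L0 : OrientedLink, SkeinTriple Lp Lm L0 → l • Q Lp + l' • Q Lm + m • Q L0 = 0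

theorem mem_of_unit_smul_add {l l' : R} (hl : l * l' = 1) {u v : M} {T : Submodule R M}
    (h : l • u + v = 0) (hv : v ∈ T) : u ∈ T := by
  have h1 : u = -(l' • v) := by
    have h2 : l' • (l • u + v) = 0 := by rw [h, smul_zero]
    rw [smul_add, smul_smul, mul_comm l', hl, one_smul] at h2
    exact eq_neg_of_add_eq_zero_left h2
  rw [h1]
  exact T.neg_mem (T.smul_mem _ hv)

/-- Braids are built up letter by letter, absorbing each letter into the function. An inverse letter
is traded, by the skein relation and the invertibility of `l`, for a positive letter and no letter.
-/
theorem IsSkeinFun.mem_of_closed {l l' m : R} (hl : l * l' = 1) {n : ℕ} {T : Submodule R M}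
    (P : (BraidGroup n → M) → Prop) (hP : ∀ f, P f → IsSkeinFun l l' m f)
    (hmul : ∀ f i, P f → P fun β => f (β * gen i)) (hone : ∀ f, P f → f 1 ∈ T)
    (f : BraidGroup n → M) (hf : P f) (β : BraidGroup n) : f β ∈ T := by
  have hβ : β ∈ Subgroup.closure (Set.range (gen (n := n))) := by
    rw [closure_range_gen]; exact Subgroup.mem_top β
  induction hβ using Subgroup.closure_induction_right generalizing f with
  | one => exact hone f hf
  | mul_right y z hz hy ih =>
    obtain ⟨i, rfl⟩ := hy
    exact ih _ (hmul f i hf)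
  | mul_inv_cancel y z hz hy ih =>
    obtain ⟨i, rfl⟩ := hy
    have h := hP f hf y 1 i
    simp only [mul_one, add_assoc] at h
    exact mem_of_unit_smul_add hl h
      (T.add_mem (T.smul_mem _ (ih _ (hmul f i hf))) (T.smul_mem _ (ih _ hf)))

/-- Modulo the skein relation, every braid is a combination of braids which contain the last
generator at most once. -/
theorem IsSkeinFun.mem_of_last_once {l l' m : R} (hl : l * l' = 1) {T : Submodule R M} (n : ℕ)
    (f : BraidGroup (n + 1) → M) (hf : IsSkeinFun l l' m f) (h1 : ∀ a, f (incl n a) ∈ T)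
    (h2 : 0 < n → ∀ a b, f (incl n a * x (n + 1) n * incl n b) ∈ T) (β : BraidGroup (n + 1)) :
    f β ∈ T := by
  induction n with
  | zero =>
    refine IsSkeinFun.mem_of_closed hl (fun f => IsSkeinFun l l' m f ∧ f 1 ∈ T) (fun f h => h.1)
      (fun f i => absurd i.2 (by omega)) (fun f h => h.2) f ⟨hf, ?_⟩ β
    simpa using h1 1
  | succ n ih =>
    set X := x (n + 1 + 1) (n + 1) with hX
    have hl' : l' * l = 1 := by rw [mul_comm, hl]
    refine IsSkeinFun.mem_of_closed hl (fun f => IsSkeinFun l l' m f ∧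
      (∀ a, f (incl (n + 1) a) ∈ T) ∧ ∀ a b, f (incl (n + 1) a * X * incl (n + 1) b) ∈ T)
      (fun f h => h.1) ?_ ?_ f ⟨hf, h1, h2 (Nat.succ_pos n)⟩ β
    swap
    · rintro f ⟨-, h1, -⟩
      simpa using h1 1
    clear h1 h2 hf f
    rintro f i ⟨hf, h1, h2⟩
    refine ⟨?_, ?_, ?_⟩
    · intro α γ j
      simpa [mul_assoc] using hf α (γ * gen i) j
    · intro a
      rcases Nat.lt_or_ge i.1 (n + 1) with hi | hi
      · have h := h1 (a * x (n + 1) i.1)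
        rwa [map_mul, incl_x hi, x_val] at h
      · have hi' : i.1 = n + 1 := by have := i.2; omega
        have hiX : gen i = x (n + 1 + 1) (n + 1) := by rw [← x_val, hi']
        have h := h2 a 1
        rwa [map_one, mul_one, hX, ← hiX] at h
    · intro a b
      rcases Nat.lt_or_ge i.1 (n + 1) with hi | hi
      · have h := h2 a (b * x (n + 1) i.1)
        rwa [map_mul, incl_x hi, x_val, ← mul_assoc] at h
      · have hi' : i.1 = n + 1 := by have := i.2; omega
        have hiX : gen i = X := by rw [← x_val, hi']
        rw [hiX]
        -- The middle factor between the two copies of `X` is the argument of a skein function on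
        -- one strand fewer, so it may be assumed to contain `x_n` at most once.
        refine ih (fun b => f (incl (n + 1) a * X * incl (n + 1) b * X)) ?_ ?_ ?_ b
        · intro α γ j
          have h := hf (incl (n + 1) a * X * incl (n + 1) α) (incl (n + 1) γ * X)
            ⟨j.1, j.2.1, Nat.lt_succ_of_lt j.2.2⟩
          rw [← incl_gen] at h
          simpa [mul_assoc] using h
        · intro c
          have hc := incl_incl_commute_x c
          rw [← hX] at hc
          -- Without `x_n` the middle factor commutes with `X`, and the resulting square of `X` is
          -- removed by the skein relation.
          have e : incl (n + 1) a * X * incl (n + 1) (incl n c) * X =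
              incl (n + 1) (a * incl n c) * X * X := by
            rw [map_mul, mul_assoc (incl (n + 1) a), ← hc.eq, ← mul_assoc]
          have h := hf (incl (n + 1) (a * incl n c) * X) 1 i
          rw [hiX, mul_inv_cancel_right] at h
          simp only [mul_one] at h
          rw [e]
          rw [add_comm (l • _), add_assoc] at h
          refine mem_of_unit_smul_add hl' h (T.add_mem (T.smul_mem _ (h1 _)) (T.smul_mem _ ?_))
          simpa using h2 (a * incl n c) 1
        · intro hn c d
          have hc := incl_incl_commute_x c
          have hd := incl_incl_commute_x d
          rw [← hX] at hc hd
          have hb := x_braid (n := n + 1 + 1) (i := n) hn (by omega)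
          rw [← hX] at hb
          -- With a single `x_n`, the braid relation turns `X x_n X` into `x_n X x_n`, leaving one
          -- `X`.
          have e : incl (n + 1) a * X * incl (n + 1) (incl n c * x (n + 1) n * incl n d) * X =
              incl (n + 1) (a * incl n c * x (n + 1) n) * X *
                incl (n + 1) (x (n + 1) n * incl n d) := by
            simp only [map_mul, incl_x (Nat.lt_succ_self n)]
            calc _ = incl (n + 1) a * (X * incl (n + 1) (incl n c)) * x (n + 1 + 1) n *
                  (incl (n + 1) (incl n d) * X) := by group
              _ = incl (n + 1) a * incl (n + 1) (incl n c) * (X * x (n + 1 + 1) n * X) *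
                  incl (n + 1) (incl n d) := by rw [← hc.eq, hd.eq]; group
              _ = _ := by rw [← hb]; group
          rw [e]
          exact h2 _ _

/-! ### Skein invariants of links -/

theorem braidClosure_conj {n : ℕ} (hn : 0 < n) (α γ : BraidGroup n) :
    braidClosure hn (γ * α * γ⁻¹) = braidClosure hn α :=
  (Quot.sound (MarkovMove.conj hn α γ)).symm

theorem braidClosure_mul_comm {n : ℕ} (hn : 0 < n) (α γ : BraidGroup n) :
    braidClosure hn (α * γ) = braidClosure hn (γ * α) := by
  rw [← braidClosure_conj hn (α * γ) γ]
  congr 1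
  group

theorem braidClosure_stab_pos {n : ℕ} (hn : 0 < n) (α : BraidGroup n) :
    braidClosure (Nat.succ_pos n) (incl n α * x (n + 1) n) = braidClosure hn α :=
  (Quot.sound (MarkovMove.stab_pos hn α)).symm

theorem braidClosure_stab_neg {n : ℕ} (hn : 0 < n) (α : BraidGroup n) :
    braidClosure (Nat.succ_pos n) (incl n α * (x (n + 1) n)⁻¹) = braidClosure hn α :=
  (Quot.sound (MarkovMove.stab_neg hn α)).symm

theorem skeinTriple_mk {n : ℕ} (hn : 0 < n) (i : ArtinIndex n) (α γ : BraidGroup n) :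
    SkeinTriple (braidClosure hn (α * (gen i)⁻¹ * γ)) (braidClosure hn (α * gen i * γ))
      (braidClosure hn (α * γ)) :=
  ⟨n, hn, i, α, γ, rfl, rfl, rfl⟩

/-- Adding an unlinked unknotted component. -/
theorem IsSkeinInvariant.closure_incl {l l' m : R} {Q : OrientedLink → M}
    (hQ : IsSkeinInvariant l l' m Q) {n : ℕ} (hn : 0 < n) (α : BraidGroup n) :
    m • Q (braidClosure (Nat.succ_pos n) (incl n α)) + (l + l') • Q (braidClosure hn α) = 0 := by
  -- At the new last crossing both `L₊` and `L₋` are stabilizations of the closure of `α`, while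
  -- `L₀` has the extra strand closed up separately.
  have h := hQ _ _ _ (skeinTriple_mk (Nat.succ_pos n) ⟨n, hn, Nat.lt_succ_self n⟩
    (incl n α) 1)
  rw [← x_eq_gen, mul_one, mul_one, mul_one, braidClosure_stab_neg hn,
    braidClosure_stab_pos hn] at h
  rw [add_smul, add_comm, h]

theorem braidGroup_one_eq_one (β : BraidGroup 1) : β = 1 := by
  have hβ : β ∈ Subgroup.closure (Set.range (gen (n := 1))) := by
    rw [closure_range_gen]; exact Subgroup.mem_top β
  have : Set.range (gen (n := 1)) = ∅ :=
    Set.range_eq_empty_iff.2 ⟨fun i => absurd i.2 (by omega)⟩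
  rwa [this, Subgroup.closure_empty, Subgroup.mem_bot] at hβ

/-- A skein invariant is determined by its value on the unknot. -/
theorem IsSkeinInvariant.mem_span_unknot {l l' m m' : R} (hl : l * l' = 1) (hm : m * m' = 1)
    {Q : OrientedLink → M} (hQ : IsSkeinInvariant l l' m Q) (L : OrientedLink) :
    Q L ∈ Submodule.span R {Q unknot} := by
  set T := Submodule.span R {Q unknot}
  have key : ∀ (n : ℕ) (β : BraidGroup (n + 1)), Q (braidClosure (Nat.succ_pos n) β) ∈ T := by
    intro n
    induction n with
    | zero =>
      intro β
      rw [braidGroup_one_eq_one β]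
      exact Submodule.mem_span_singleton_self _
    | succ n ih =>
      refine IsSkeinFun.mem_of_last_once (l := l) (l' := l') (m := m) hl (n + 1)
        (fun β => Q (braidClosure (Nat.succ_pos (n + 1)) β)) ?_ ?_ ?_
      · intro α γ i
        exact hQ _ _ _ (skeinTriple_mk _ i α γ)
      · intro a
        exact mem_of_unit_smul_add hm (hQ.closure_incl (Nat.succ_pos n) a) (T.smul_mem _ (ih a))
      · intro _ a b
        have e : braidClosure (Nat.succ_pos (n + 1))
            (incl (n + 1) a * x (n + 1 + 1) (n + 1) * incl (n + 1) b) =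
            braidClosure (Nat.succ_pos n) (b * a) := by
          rw [braidClosure_mul_comm, ← mul_assoc, ← map_mul, braidClosure_stab_pos]
        simp only [e]
        exact ih _
  obtain ⟨n, hn, β⟩ := L
  obtain ⟨n, rfl⟩ : ∃ n', n = n' + 1 := ⟨n - 1, by omega⟩
  exact key n β

end Skein

/-! ### Uniqueness of the HOMFLY polynomial -/

theorem lPow_add (a b : ℤ) : lPow (a + b) = lPow a * lPow b := by
  rw [lPow, LaurentPolynomial.T_add, map_mul]; rfl

theorem lPow_mul_neg : lPow 1 * lPow (-1) = 1 := by
  rw [← lPow_add]; simp [lPow]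

theorem mPow_mul_neg : mPow 1 * mPow (-1) = 1 := by
  rw [mPow, mPow, ← LaurentPolynomial.T_add]; simp

theorem IsHomfly.isSkeinInvariant {P : OrientedLink → HomflyRing} (h : IsHomfly P) :
    IsSkeinInvariant (lPow 1) (lPow (-1)) (mPow 1) P := h.2

theorem IsHomfly.unique {P P' : OrientedLink → HomflyRing} (h : IsHomfly P) (h' : IsHomfly P') :
    P = P' := by
  have hs : IsSkeinInvariant (lPow 1) (lPow (-1)) (mPow 1) fun L => P L - P' L := by
    intro Lp Lm L0 ht
    have h1 := h.2 _ _ _ ht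
    have h2 := h'.2 _ _ _ ht
    simp only [smul_eq_mul]
    linear_combination h1 - h2
  funext L
  have := hs.mem_span_unknot lPow_mul_neg mPow_mul_neg L
  rw [h.1, h'.1, sub_self, Submodule.span_zero_singleton, Submodule.mem_bot] at this
  exact sub_eq_zero.1 this

/-! ### Values on simple braids -/

theorem IsHomfly.closure_incl {P : OrientedLink → HomflyRing} (h : IsHomfly P) {n : ℕ} (hn : 0 < n)
    (α : BraidGroup n) : P (braidClosure (Nat.succ_pos n) (incl n α)) =
      delta * P (braidClosure hn α) := by
  have h1 := h.isSkeinInvariant.closure_incl hn α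
  simp only [smul_eq_mul] at h1
  rw [delta]
  linear_combination mPow (-1) * h1 -
    P (braidClosure (Nat.succ_pos n) (incl n α)) * mPow_mul_neg

theorem exists_incl_word {n : ℕ} (w : List (ArtinIndex (n + 1))) (hw : ∀ i ∈ w, i.1 < n) :
    ∃ u : List (ArtinIndex n), u.length = w.length ∧ (w.Nodup → u.Nodup) ∧
      (w.map gen).prod = incl n (u.map gen).prod := by
  refine ⟨w.pmap (fun i hi => ⟨i.1, i.2.1, hi⟩) hw, by simp, ?_, ?_⟩
  · intro hnd
    refine hnd.pmap ?_
    intro a _ b _ hab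
    exact Subtype.ext (Subtype.mk.inj hab)
  · rw [map_list_prod, List.map_map, List.map_pmap]
    congr 1
    rw [← List.pmap_eq_map (fun _ _ => trivial) (p := fun _ => True)]
    refine List.pmap_congr_left _ fun i _ _ h => ?_
    simp [incl_gen]

theorem IsHomfly.nodup_word {P : OrientedLink → HomflyRing} (h : IsHomfly P) (n : ℕ)
    (w : List (ArtinIndex (n + 1))) (hw : w.Nodup) : w.length ≤ n ∧
      P (braidClosure (Nat.succ_pos n) (w.map gen).prod) = delta ^ (n - w.length) := by
  induction n with
  | zero =>
    obtain rfl : w = [] := List.eq_nil_iff_forall_not_mem.2 fun i => absurd i.2 (by omega)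
    exact ⟨le_rfl, h.1⟩
  | succ n ih =>
    let i : ArtinIndex (n + 1 + 1) := ⟨n + 1, Nat.succ_pos n, Nat.lt_succ_self _⟩
    have hlt : ∀ j : ArtinIndex (n + 1 + 1), j ≠ i → j.1 < n + 1 := by
      intro j hj
      have h1 := j.2
      have h2 : j.1 ≠ n + 1 := fun h' => hj (Subtype.ext h')
      omega
    by_cases hi : i ∈ w
    · obtain ⟨p, q, rfl⟩ := List.append_of_mem hi
      have hnd : (i :: (q ++ p)).Nodup := by
        refine (List.Perm.nodup_iff ?_).2 hw
        exact List.perm_append_comm (l₁ := i :: q) (l₂ := p)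
      rw [List.nodup_cons] at hnd
      obtain ⟨u, hu, hun, hprod⟩ := exists_incl_word (q ++ p) fun j hj => hlt j (by
        rintro rfl; exact hnd.1 hj)
      obtain ⟨hlen, hval⟩ := ih u (hun hnd.2)
      have e : braidClosure (Nat.succ_pos (n + 1)) ((p ++ i :: q).map gen).prod =
          braidClosure (Nat.succ_pos n) (u.map gen).prod := by
        rw [← braidClosure_stab_pos _ (u.map gen).prod, ← hprod, x_eq_gen i.2]
        simp only [List.map_append, List.map_cons, List.prod_append, List.prod_cons]
        rw [← mul_assoc, braidClosure_mul_comm, mul_assoc]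
      simp only [List.length_append, List.length_cons] at hu ⊢
      refine ⟨by omega, ?_⟩
      rw [e, hval]
      congr 1
      omega
    · obtain ⟨u, hu, hun, hprod⟩ := exists_incl_word w fun j hj => hlt j (by
        rintro rfl; exact hi hj)
      obtain ⟨hlen, hval⟩ := ih u (hun hw)
      refine ⟨by omega, ?_⟩
      rw [hprod, h.closure_incl (Nat.succ_pos n), hval, ← pow_succ', hu]
      congr 1
      omega

theorem IsHomfly.isSimple {P : OrientedLink → HomflyRing} (h : IsHomfly P) {n : ℕ} (hn : 0 < n)
    {β : BraidGroup n} (hβ : IsSimple β) :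
    ∃ k : ℕ, (k : ℤ) = n - degree β - 1 ∧ P (braidClosure hn β) = delta ^ k := by
  obtain ⟨w, hw, rfl⟩ := hβ
  obtain ⟨n, rfl⟩ : ∃ n', n = n' + 1 := ⟨n - 1, by omega⟩
  obtain ⟨h1, h2⟩ := h.nodup_word n w hw
  refine ⟨n - w.length, ?_, h2⟩
  rw [degree_word]
  push_cast [h1]
  ring

theorem IsHomfly.canonicalBraid {P : OrientedLink → HomflyRing} (h : IsHomfly P) {n : ℕ}
    (hn : 0 < n) (A : List ℕ) (hA : ∀ a ∈ A, 1 ≤ a) (hsum : A.sum ≤ n) :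
    P (braidClosure hn (canonicalBraid n A)) = delta ^ (n - A.sum + A.length - 1) := by
  obtain ⟨w, hw, hlen, hprod⟩ := exists_word_canonicalBraid A hA hsum
  obtain ⟨n, rfl⟩ : ∃ n', n = n' + 1 := ⟨n - 1, by omega⟩
  obtain ⟨h1, h2⟩ := h.nodup_word n w hw
  rw [← hprod, h2]
  congr 1
  omega

/-! ### Specializations -/

theorem specialize_delta (u v : (RatFunc ℂ)ˣ) :
    specialize u v delta = -((u + (u : RatFunc ℂ)⁻¹) / v) := by
  simp [delta, specialize, lPow, mPow, div_eq_mul_inv]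

theorem iota_sq : iota * iota = -1 := by
  rw [iota, ← map_mul, Complex.I_mul_I, map_neg, map_one]

theorem iota_inv : iota⁻¹ = -iota := by
  rw [inv_eq_iff_eq_inv]
  apply eq_inv_of_mul_eq_one_left
  rw [mul_neg, iota_sq, neg_neg]

/-- At `l = ι` one has `l + l⁻¹ = 0`, whatever the value of `m`. -/
theorem specialize_conway_delta (u v : (RatFunc ℂ)ˣ) (hu : (u : RatFunc ℂ) = iota) :
    specialize u v delta = 0 := by
  rw [specialize_delta, hu, iota_inv]
  simp

theorem specialize_jones_delta (u v : (RatFunc ℂ)ˣ) (hu : (u : RatFunc ℂ) = iota * sVar ^ 2)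
    (hv : (v : RatFunc ℂ) = iota * (sVar - sVar⁻¹)) :
    specialize u v delta = -((sVar ^ 2 + 1) / sVar) := by
  have h0 := s_ne_zero
  have h1 := iota_ne_zero
  have h2 := s_sub_inv_ne_zero
  have h3 : sVar * sVar - 1 ≠ 0 := by
    intro h
    apply h2
    field_simp
    linear_combination h
  rw [specialize_delta, hu, hv, mul_inv, iota_inv]
  congr 1
  rw [div_eq_div_iff (mul_ne_zero h1 h2) h0]
  field_simp
  ring

theorem specialize_dPoly_delta (u v : (RatFunc ℂ)ˣ) (hu : (u : RatFunc ℂ) = sVar)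
    (hv : (v : RatFunc ℂ) = -2) :
    specialize u v delta = (sVar ^ 2 + 1) / (2 * sVar) := by
  have h0 := s_ne_zero
  have h2 : (2 : RatFunc ℂ) ≠ 0 := two_ne_zero
  rw [specialize_delta, hu, hv]
  field_simp

/-! ### State sums -/

/-- The parameters of a vertex model with `N` colours: a solution `q`, `z` of `z = q - q⁻¹`, a
rescaling `c` (with inverse `c'`) of the braiding, and weights `μ` of the colours for which the
state sum of a closed braid is invariant under stabilization. -/
structure VertexModel (N : ℕ) where
  q : ℂ
  z : ℂ
  c : ℂ
  c' : ℂ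
  μ : Fin N → ℂ
  z_mul_q : z * q = q * q - 1
  c_mul_c' : c * c' = 1
  -- The brackets in this and the next condition are the weighted partial traces over the last
  -- strand of the unnormalized braiding and of its inverse, the other strand at the crossing having
  -- colour `a`.
  sum_pos : ∀ a, c * (μ a + ∑ b, μ b * (if a = b then q - 1 else if a < b then z else 0)) = 1
  sum_neg : ∀ a, c' * (μ a + ∑ b, μ b * (if a = b then q - 1 else if a < b then z else 0)
    - z * ∑ b, μ b) = 1

namespace VertexModel

variable {N : ℕ} (V : VertexModel N)

/-- The diagonal coefficient of the braiding at a pair of colours. -/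
def weight (a b : Fin N) : ℂ := if a = b then V.q - 1 else if a < b then V.z else 0

theorem weight_self (a : Fin N) : V.weight a a = V.q - 1 := if_pos rfl

theorem weight_of_lt {a b : Fin N} (h : a < b) : V.weight a b = V.z := by
  rw [weight, if_neg h.ne, if_pos h]

theorem weight_of_gt {a b : Fin N} (h : b < a) : V.weight a b = 0 := by
  rw [weight, if_neg h.ne', if_neg h.not_gt]

/-- The space of functions on the colourings of `n` strands. -/
abbrev States (N n : ℕ) : Type := (Fin n → Fin N) → ℂ

/-- The (unnormalized) braiding at the crossing `x_i`. -/
def op {n : ℕ} (i : ArtinIndex n) : Module.End ℂ (States N n) where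
  toFun f c := f (c ∘ transp i) + V.weight (c (leftPos i)) (c (rightPos i)) * f c
  map_add' f g := by funext c; simp only [Pi.add_apply]; ring
  map_smul' r f := by
    funext c; simp only [Pi.smul_apply, smul_eq_mul, RingHom.id_apply]; ring

theorem op_apply {n : ℕ} (i : ArtinIndex n) (f : States N n) (c : Fin n → Fin N) :
    V.op i f c = f (c ∘ transp i) + V.weight (c (leftPos i)) (c (rightPos i)) * f c := rfl

theorem comp_transp_of_eq {n : ℕ} {i : ArtinIndex n} {c : Fin n → Fin N}
    (h : c (leftPos i) = c (rightPos i)) : c ∘ transp i = c := by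
  funext j
  simp only [Function.comp_apply]
  rcases eq_or_ne j (leftPos i) with rfl | h1
  · rw [transp_left, h]
  · rcases eq_or_ne j (rightPos i) with rfl | h2
    · rw [transp_right, h]
    · rw [transp_of_ne h1 h2]

theorem comp_transp_transp {n : ℕ} (i : ArtinIndex n) (c : Fin n → Fin N) :
    (c ∘ transp i) ∘ transp i = c := by
  funext j
  simp [transp]

/-- The Hecke relation: it gives the inverse `op - z` and later the skein relation. On equal colours
the exchange term already contributes `1`, so the weight `q - 1` makes the eigenvalue `q`. -/
theorem op_mul_op {n : ℕ} (i : ArtinIndex n) : V.op i * V.op i = V.z • V.op i + 1 := by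
  refine LinearMap.ext fun f => funext fun c => ?_
  have hz := V.z_mul_q
  simp only [Module.End.mul_apply, op_apply, comp_transp_transp, Function.comp_apply, transp_left,
    transp_right, LinearMap.add_apply, LinearMap.smul_apply, Module.End.one_apply, Pi.add_apply,
    Pi.smul_apply, smul_eq_mul]
  rcases lt_trichotomy (c (leftPos i)) (c (rightPos i)) with h | h | h
  · rw [V.weight_of_lt h, V.weight_of_gt h]
    ring
  · rw [comp_transp_of_eq h, h, V.weight_self]
    linear_combination (-f c) * hz
  · rw [V.weight_of_lt h, V.weight_of_gt h]
    ring

theorem op_comm {n : ℕ} {i j : ArtinIndex n} (h : i.1 + 2 ≤ j.1) :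
    V.op i * V.op j = V.op j * V.op i := by
  obtain ⟨h1, h2, h3, h4⟩ := far_positions h
  have hc : ∀ c : Fin n → Fin N, (c ∘ transp i) ∘ transp j = (c ∘ transp j) ∘ transp i := by
    intro c
    rw [Function.comp_assoc, Function.comp_assoc, ← Equiv.Perm.coe_mul, ← Equiv.Perm.coe_mul,
      transp_comm h]
  refine LinearMap.ext fun f => funext fun c => ?_
  simp only [Module.End.mul_apply, op_apply, Function.comp_apply, transp_of_ne h1 h2,
    transp_of_ne h3 h4, transp_of_ne h1.symm h3.symm, transp_of_ne h2.symm h4.symm, hc]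
  ring

/-- This is what is left of the braid relation after the terms common to both sides cancel. The
values `u`, `v`, `w` belong to the colourings with the first pair exchanged, the second pair
exchanged, and neither; exchanging equal colours changes nothing, whence `hu` and `hv`. -/
theorem weight_identity (a b d : Fin N) (u v w : ℂ) (hu : a = b → u = w) (hv : b = d → v = w) :
    (V.weight a d * V.weight b a + V.weight a b * V.weight b d
        - V.weight b d * V.weight a d) * u +
      (V.weight a b * V.weight a d - V.weight a d * V.weight d b
        - V.weight b d * V.weight a b) * v +
      V.weight a b * V.weight b d * (V.weight a b - V.weight b d) * w = 0 := by
  have hz := V.z_mul_q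
  rcases lt_trichotomy a b with h1 | h1 | h1
  · rw [V.weight_of_lt h1, V.weight_of_gt h1]
    rcases lt_trichotomy b d with h2 | h2 | h2
    · rw [V.weight_of_lt h2, V.weight_of_gt h2, V.weight_of_lt (h1.trans h2)]
      ring
    · rw [hv h2, ← h2, V.weight_self, V.weight_of_lt h1]
      linear_combination (V.z * w) * hz
    · rw [V.weight_of_lt h2, V.weight_of_gt h2]
      ring
  · rw [hu h1, ← h1, V.weight_self]
    rcases lt_trichotomy a d with h2 | h2 | h2
    · rw [V.weight_of_lt h2, V.weight_of_gt h2]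
      linear_combination (-V.z * w) * hz
    · rw [hv (h1.symm.trans h2), ← h2, V.weight_self]
      ring
    · rw [V.weight_of_lt h2, V.weight_of_gt h2]
      ring
  · rw [V.weight_of_lt h1, V.weight_of_gt h1]
    rcases lt_trichotomy b d with h2 | h2 | h2
    · rw [V.weight_of_lt h2, V.weight_of_gt h2]
      ring
    · rw [← h2, V.weight_self, V.weight_of_gt h1]
      ring
    · rw [V.weight_of_gt h2, V.weight_of_lt h2, V.weight_of_gt (h2.trans h1)]
      ring

theorem op_braid {n : ℕ} {i j : ArtinIndex n} (h : j.1 = i.1 + 1) :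
    V.op i * V.op j * V.op i = V.op j * V.op i * V.op j := by
  have hij := rightPos_eq_leftPos h
  have h1 := leftPos_ne_rightPos i
  have h2 := leftPos_ne_rightPos j
  have h3 := leftPos_ne_of_adjacent h
  rw [hij] at h1
  have e1 : transp i (leftPos j) = leftPos i := by rw [← hij, transp_right]
  have e2 : transp i (leftPos i) = leftPos j := by rw [transp_left, hij]
  have e3 : transp i (rightPos j) = rightPos j := transp_of_ne h3.symm (by rw [hij]; exact h2.symm)
  have e4 : transp j (leftPos i) = leftPos i := transp_of_ne h1 h3
  have hc : ∀ c : Fin n → Fin N, ((c ∘ transp i) ∘ transp j) ∘ transp i =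
      ((c ∘ transp j) ∘ transp i) ∘ transp j := by
    intro c
    simp only [Function.comp_assoc, ← Equiv.Perm.coe_mul]
    rw [transp_braid h]
  refine LinearMap.ext fun f => funext fun c => ?_
  simp only [Module.End.mul_apply, op_apply, Function.comp_apply, hij, e1, e2, e3, e4,
    transp_left j, transp_right j, comp_transp_transp, hc]
  have key := V.weight_identity (c (leftPos i)) (c (leftPos j)) (c (rightPos j))
    (f (c ∘ transp i)) (f (c ∘ transp j)) (f c)
    (fun h' => by rw [comp_transp_of_eq (by rw [hij]; exact h')])
    (fun h' => by rw [comp_transp_of_eq h'])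
  linear_combination key

/-- The normalized braiding. -/
def opUnit {n : ℕ} (i : ArtinIndex n) : (Module.End ℂ (States N n))ˣ where
  val := V.c • V.op i
  inv := V.c' • (V.op i - V.z • 1)
  val_inv := by
    rw [smul_mul_smul_comm, V.c_mul_c', one_smul, mul_sub, op_mul_op, mul_smul_comm, mul_one]
    abel
  inv_val := by
    rw [smul_mul_smul_comm, mul_comm, V.c_mul_c', one_smul, sub_mul, op_mul_op, smul_mul_assoc,
      one_mul]
    abel

/-- The representation of the braid group defined by a vertex model. -/
def rep (n : ℕ) : BraidGroup n →* (Module.End ℂ (States N n))ˣ :=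
  PresentedGroup.toGroup (f := V.opUnit) (by
    rintro r (⟨i, j, h, rfl⟩ | ⟨i, j, h, rfl⟩)
    · simp only [map_mul, map_inv, FreeGroup.lift_apply_of]
      rw [mul_inv_eq_one]
      ext1
      simp only [Units.val_mul, opUnit, smul_mul_smul_comm, V.op_comm h]
    · simp only [map_mul, map_inv, FreeGroup.lift_apply_of]
      rw [mul_inv_eq_one]
      ext1
      simp only [Units.val_mul, opUnit, smul_mul_smul_comm, V.op_braid h])

theorem rep_gen {n : ℕ} (i : ArtinIndex n) : V.rep n (gen i) = V.opUnit i :=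
  PresentedGroup.toGroup.of _

/-- The product of the weights of the colours. -/
def density (n : ℕ) : Module.End ℂ (States N n) where
  toFun f c := (∏ j, V.μ (c j)) * f c
  map_add' f g := by funext c; simp only [Pi.add_apply]; ring
  map_smul' r f := by
    funext c; simp only [Pi.smul_apply, smul_eq_mul, RingHom.id_apply]; ring

theorem density_apply {n : ℕ} (f : States N n) (c : Fin n → Fin N) :
    V.density n f c = (∏ j, V.μ (c j)) * f c := rfl

theorem density_commute_op {n : ℕ} (i : ArtinIndex n) : Commute (V.density n) (V.op i) := by
  change _ * _ = _ * _
  refine LinearMap.ext fun f => funext fun c => ?_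
  have h : ∏ j, V.μ (c (transp i j)) = ∏ j, V.μ (c j) :=
    Equiv.prod_comp (transp i) fun j => V.μ (c j)
  simp only [Module.End.mul_apply, op_apply, density_apply, Function.comp_apply, h]
  ring

theorem density_commute_rep {n : ℕ} (β : BraidGroup n) :
    Commute (V.density n) (V.rep n β : Module.End ℂ (States N n)) := by
  have hβ : β ∈ Subgroup.closure (Set.range (gen (n := n))) := by
    rw [closure_range_gen]; exact Subgroup.mem_top β
  induction hβ using Subgroup.closure_induction with
  | mem y hy =>
    obtain ⟨i, rfl⟩ := hy
    rw [rep_gen]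
    exact (V.density_commute_op i).smul_right _
  | one => rw [map_one]; exact Commute.one_right _
  | mul _ _ _ _ h1 h2 => rw [map_mul]; exact h1.mul_right h2
  | inv _ _ h1 => rw [map_inv]; exact h1.units_inv_right

/-- The weighted trace of an operator on states. -/
noncomputable def wtr {n : ℕ} : Module.End ℂ (States N n) →ₗ[ℂ] ℂ :=
  LinearMap.trace ℂ (States N n) ∘ₗ LinearMap.mulLeft ℂ (V.density n)

theorem wtr_apply {n : ℕ} (A : Module.End ℂ (States N n)) :
    V.wtr A = LinearMap.trace ℂ (States N n) (V.density n * A) := rfl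

theorem wtr_eq_sum {n : ℕ} (A : Module.End ℂ (States N n)) :
    V.wtr A = ∑ c : Fin n → Fin N, (∏ j, V.μ (c j)) * A (Pi.single c 1) c := by
  rw [wtr_apply, LinearMap.trace_eq_matrix_trace ℂ (Pi.basisFun ℂ (Fin n → Fin N)), Matrix.trace]
  refine Finset.sum_congr rfl fun c _ => ?_
  rw [Matrix.diag_apply, LinearMap.toMatrix_apply]
  simp [density_apply]

theorem wtr_conj {n : ℕ} (α γ : BraidGroup n) :
    V.wtr (V.rep n (γ * α * γ⁻¹) : Module.End ℂ (States N n)) = V.wtr (V.rep n α).val := by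
  rw [wtr_apply, map_mul (V.rep n), map_mul (V.rep n), Units.val_mul, Units.val_mul, ← mul_assoc,
    LinearMap.trace_mul_comm, ← mul_assoc (V.density n), (V.density_commute_rep γ).eq, mul_assoc,
    ← mul_assoc _ (V.rep n γ : Module.End ℂ (States N n)), map_inv, Units.inv_mul, one_mul,
    wtr_apply]

/-! ### Stabilization of state sums -/

/-- Add a last strand of a given colour. -/
def addLast {n : ℕ} (c : Fin n → Fin N) (b : Fin N) : Fin (n + 1) → Fin N :=
  Fin.snoc (α := fun _ => Fin N) c b

theorem addLast_castSucc {n : ℕ} (c : Fin n → Fin N) (b : Fin N) (j : Fin n) :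
    addLast c b j.castSucc = c j := Fin.snoc_castSucc ..

theorem addLast_last {n : ℕ} (c : Fin n → Fin N) (b : Fin N) :
    addLast c b (Fin.last n) = b := Fin.snoc_last ..

theorem addLast_inj {n : ℕ} {c c' : Fin n → Fin N} {b b' : Fin N} :
    addLast c b = addLast c' b' ↔ c = c' ∧ b = b' := Fin.snoc_inj

theorem sum_addLast {n : ℕ} (F : (Fin (n + 1) → Fin N) → ℂ) :
    ∑ c, F c = ∑ c : Fin n → Fin N, ∑ b : Fin N, F (addLast c b) := by
  rw [← Equiv.sum_comp (Fin.snocEquiv fun _ => Fin N), Fintype.sum_prod_type, Finset.sum_comm]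
  rfl

theorem prod_addLast {n : ℕ} (c : Fin n → Fin N) (b : Fin N) :
    ∏ j, V.μ (addLast c b j) = (∏ j, V.μ (c j)) * V.μ b := by
  rw [Fin.prod_univ_castSucc]
  simp only [addLast_castSucc, addLast_last]

/-- Restriction to the colourings with a given last colour. -/
def restrictLast {n : ℕ} (b : Fin N) : States N (n + 1) →ₗ[ℂ] States N n :=
  LinearMap.funLeft ℂ ℂ fun c => addLast c b

theorem restrictLast_apply {n : ℕ} (b : Fin N) (f : States N (n + 1)) (c : Fin n → Fin N) :
    restrictLast b f c = f (addLast c b) := rfl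

theorem restrictLast_op {n : ℕ} (i : ArtinIndex n) (b : Fin N) :
    restrictLast b ∘ₗ V.op (⟨i.1, i.2.1, Nat.lt_succ_of_lt i.2.2⟩ : ArtinIndex (n + 1)) =
      V.op i ∘ₗ restrictLast b := by
  set i' : ArtinIndex (n + 1) := ⟨i.1, i.2.1, Nat.lt_succ_of_lt i.2.2⟩ with hi'
  have hl : leftPos i' = (leftPos i).castSucc := rfl
  have hr : rightPos i' = (rightPos i).castSucc := rfl
  have ht : ∀ c : Fin n → Fin N, addLast c b ∘ transp i' = addLast (c ∘ transp i) b := by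
    intro c
    funext j
    simp only [Function.comp_apply]
    refine Fin.lastCases ?_ (fun j => ?_) j
    · rw [transp_of_ne, addLast_last, addLast_last]
      · rw [hl]; exact (Fin.castSucc_lt_last _).ne'
      · rw [hr]; exact (Fin.castSucc_lt_last _).ne'
    · rw [addLast_castSucc, Function.comp_apply]
      rcases eq_or_ne j (leftPos i) with rfl | h1
      · rw [← hl, transp_left, transp_left, hr, addLast_castSucc]
      · rcases eq_or_ne j (rightPos i) with rfl | h2
        · rw [← hr, transp_right, transp_right, hl, addLast_castSucc]
        · rw [transp_of_ne h1 h2, transp_of_ne, addLast_castSucc]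
          · rw [hl]; exact fun h => h1 (Fin.castSucc_injective _ h)
          · rw [hr]; exact fun h => h2 (Fin.castSucc_injective _ h)
  refine LinearMap.ext fun f => funext fun c => ?_
  simp only [LinearMap.comp_apply, restrictLast_apply, op_apply, ht, hl, hr, addLast_castSucc]

theorem restrictLast_rep {n : ℕ} (α : BraidGroup n) (b : Fin N) :
    restrictLast b ∘ₗ (V.rep (n + 1) (incl n α)).val = (V.rep n α).val ∘ₗ restrictLast b := by
  have hα : α ∈ Subgroup.closure (Set.range (gen (n := n))) := by
    rw [closure_range_gen]; exact Subgroup.mem_top α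
  induction hα using Subgroup.closure_induction with
  | mem y hy =>
    obtain ⟨i, rfl⟩ := hy
    rw [incl_gen, rep_gen, rep_gen]
    simp only [opUnit, LinearMap.comp_smul, LinearMap.smul_comp, restrictLast_op]
  | one => simp only [map_one, Units.val_one]; rfl
  | mul y z _ _ h1 h2 =>
    simp only [map_mul, Units.val_mul, Module.End.mul_eq_comp]
    rw [← LinearMap.comp_assoc, h1, LinearMap.comp_assoc, h2, LinearMap.comp_assoc]
  | inv y _ h1 =>
    rw [map_inv, map_inv, map_inv]
    set A := V.rep (n + 1) (incl n y)
    set B := V.rep n y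
    have hA : A.val ∘ₗ A⁻¹.val = LinearMap.id := A.mul_inv
    have hB : B⁻¹.val ∘ₗ B.val = LinearMap.id := B.inv_mul
    calc _ = (B⁻¹.val ∘ₗ B.val) ∘ₗ restrictLast b ∘ₗ A⁻¹.val := by rw [hB, LinearMap.id_comp]
      _ = B⁻¹.val ∘ₗ (B.val ∘ₗ restrictLast b) ∘ₗ A⁻¹.val := by simp only [LinearMap.comp_assoc]
      _ = B⁻¹.val ∘ₗ restrictLast b ∘ₗ A.val ∘ₗ A⁻¹.val := by
        rw [← h1]; simp only [LinearMap.comp_assoc]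
      _ = _ := by rw [hA, LinearMap.comp_id]

/-- The included braid does not act on the last colour, so the last strand can be traced out first;
by `hB` the weighted partial trace of `B` is the scalar `k`. -/
theorem wtr_rep_incl_mul {n : ℕ} (α : BraidGroup n) (B : Module.End ℂ (States N (n + 1)))
    (k : ℂ) (hB : ∀ c c' : Fin n → Fin N,
      ∑ b, V.μ b * B (Pi.single (addLast c b) 1) (addLast c' b) =
        k * (Pi.single c 1 : States N n) c') :
    V.wtr ((V.rep (n + 1) (incl n α)).val * B) = k * V.wtr (V.rep n α).val := by
  rw [wtr_eq_sum, wtr_eq_sum, sum_addLast, Finset.mul_sum]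
  refine Finset.sum_congr rfl fun c _ => ?_
  have h1 : ∀ b, ((V.rep (n + 1) (incl n α)).val * B) (Pi.single (addLast c b) 1) (addLast c b) =
      (V.rep n α).val (restrictLast b (B (Pi.single (addLast c b) 1))) c := by
    intro b
    exact congrFun (LinearMap.congr_fun (V.restrictLast_rep α b) _) c
  have h2 : ∑ b, V.μ b • restrictLast b (B (Pi.single (addLast c b) 1)) =
      k • (Pi.single c 1 : States N n) := by
    funext c'
    simp only [Finset.sum_apply, Pi.smul_apply, restrictLast_apply, smul_eq_mul]
    exact hB c c'
  have h3 := congrFun (congrArg (V.rep n α).val h2) c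
  simp only [map_sum, map_smul, Finset.sum_apply, Pi.smul_apply, smul_eq_mul] at h3
  simp only [h1, prod_addLast]
  calc _ = (∏ j, V.μ (c j)) * ∑ b, V.μ b *
        (V.rep n α).val (restrictLast b (B (Pi.single (addLast c b) 1))) c := by
        rw [Finset.mul_sum]; exact Finset.sum_congr rfl fun b _ => by ring
    _ = _ := by rw [h3]; ring

/-- The exchange term survives only if the last colour equals that of the neighbouring strand,
giving the single summand `μ`; the diagonal term gives the weighted sum. -/
theorem sum_op_last {n : ℕ} (hn : 0 < n) (c c' : Fin n → Fin N) :
    ∑ b, V.μ b * V.op (⟨n, hn, Nat.lt_succ_self n⟩ : ArtinIndex (n + 1))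
        (Pi.single (addLast c b) 1) (addLast c' b) =
      (V.μ (c ⟨n - 1, by omega⟩) + ∑ b, V.μ b * V.weight (c ⟨n - 1, by omega⟩) b) *
        (Pi.single c 1 : States N n) c' := by
  set i : ArtinIndex (n + 1) := ⟨n, hn, Nat.lt_succ_self n⟩ with hi
  set p : Fin n := ⟨n - 1, by omega⟩ with hp
  have hl : leftPos i = p.castSucc := rfl
  have hr : rightPos i = Fin.last n := rfl
  have hval : ∀ b, addLast c' b (leftPos i) = c' p := fun b => by rw [hl, addLast_castSucc]
  have hval' : ∀ b, addLast c' b (rightPos i) = b := fun b => by rw [hr, addLast_last]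
  have h1 : ∀ b, (Pi.single (addLast c b) 1 : States N (n + 1)) (addLast c' b ∘ transp i) =
      if c' = c ∧ b = c p then 1 else 0 := by
    intro b
    rw [Pi.single_apply]
    congr 1
    rw [eq_iff_iff]
    constructor
    · intro h
      have hb : b = c' p := by
        have h' := congrFun h (Fin.last n)
        rw [Function.comp_apply, ← hr, transp_right, hval, hr, addLast_last] at h'
        exact h'.symm
      rw [comp_transp_of_eq (by rw [hval, hval', hb]), addLast_inj] at h
      exact ⟨h.1, by rw [hb, h.1]⟩
    · rintro ⟨rfl, hb⟩
      exact comp_transp_of_eq (by rw [hval, hval', hb])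
  have h2 : ∀ b, (Pi.single (addLast c b) 1 : States N (n + 1)) (addLast c' b) =
      if c' = c then 1 else 0 := by
    intro b
    rw [Pi.single_apply]
    congr 1
    rw [addLast_inj]
    simp
  simp only [op_apply, h1, h2, hval, hval', Pi.single_apply]
  by_cases h : c' = c
  · subst h
    simp [mul_add, Finset.sum_add_distrib]
  · simp [h]

theorem sum_one_last {n : ℕ} (c c' : Fin n → Fin N) :
    ∑ b, V.μ b * (1 : Module.End ℂ (States N (n + 1)))
        (Pi.single (addLast c b) 1) (addLast c' b) =
      (∑ b, V.μ b) * (Pi.single c 1 : States N n) c' := by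
  simp only [Module.End.one_apply, Pi.single_apply, addLast_inj, and_true, Finset.sum_mul]

theorem wtr_stab_pos {n : ℕ} (hn : 0 < n) (α : BraidGroup n) :
    V.wtr (V.rep (n + 1) (incl n α * x (n + 1) n)).val = V.wtr (V.rep n α).val := by
  rw [map_mul, Units.val_mul, x_eq_gen ⟨hn, Nat.lt_succ_self n⟩, rep_gen]
  rw [V.wtr_rep_incl_mul α _ 1, one_mul]
  intro c c'
  have h := V.sum_op_last hn c c'
  have hp := V.sum_pos (c ⟨n - 1, by omega⟩)
  simp only [opUnit, LinearMap.smul_apply, Pi.smul_apply, smul_eq_mul]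
  calc _ = V.c * ((V.μ (c ⟨n - 1, by omega⟩) + ∑ b, V.μ b * V.weight (c ⟨n - 1, by omega⟩) b) *
        (Pi.single c 1 : States N n) c') := by
        rw [← h, Finset.mul_sum]; exact Finset.sum_congr rfl fun b _ => by ring
    _ = _ := by rw [← mul_assoc]; exact congrArg (· * _) hp

theorem wtr_stab_neg {n : ℕ} (hn : 0 < n) (α : BraidGroup n) :
    V.wtr (V.rep (n + 1) (incl n α * (x (n + 1) n)⁻¹)).val = V.wtr (V.rep n α).val := by
  rw [map_mul, map_inv, Units.val_mul, x_eq_gen ⟨hn, Nat.lt_succ_self n⟩, rep_gen]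
  rw [V.wtr_rep_incl_mul α _ 1, one_mul]
  intro c c'
  have h := V.sum_op_last hn c c'
  have h' := V.sum_one_last c c'
  have hp := V.sum_neg (c ⟨n - 1, by omega⟩)
  have hinv : ∀ i : ArtinIndex (n + 1), (V.opUnit i)⁻¹.val = V.c' • (V.op i - V.z • 1) :=
    fun i => rfl
  simp only [hinv, LinearMap.smul_apply, LinearMap.sub_apply, Pi.smul_apply, Pi.sub_apply,
    smul_eq_mul]
  calc _ = V.c' * ((V.μ (c ⟨n - 1, by omega⟩) + ∑ b, V.μ b * V.weight (c ⟨n - 1, by omega⟩) b) *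
        (Pi.single c 1 : States N n) c' -
          V.z * ((∑ b, V.μ b) * (Pi.single c 1 : States N n) c')) := by
        rw [← h, ← h', Finset.mul_sum, ← Finset.sum_sub_distrib, Finset.mul_sum]
        exact Finset.sum_congr rfl fun b _ => by ring
    _ = _ := by rw [← mul_assoc V.z, ← sub_mul, ← mul_assoc]; exact congrArg (· * _) hp

/-- The state sum of a closed braid, as a function on links. -/
noncomputable def linkInvariant (L : OrientedLink) : ℂ :=
  Quot.lift (fun b : ClosedBraid => V.wtr (V.rep b.strands b.braid).val) (by
    rintro _ _ (⟨hn, α, γ⟩ | ⟨hn, α⟩ | ⟨hn, α⟩)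
    · exact (V.wtr_conj α γ).symm
    · exact (V.wtr_stab_pos hn α).symm
    · exact (V.wtr_stab_neg hn α).symm) L

theorem linkInvariant_braidClosure {n : ℕ} (hn : 0 < n) (β : BraidGroup n) :
    V.linkInvariant (braidClosure hn β) = V.wtr (V.rep n β).val := rfl

theorem linkInvariant_unknot : V.linkInvariant unknot = ∑ b, V.μ b := by
  rw [unknot, linkInvariant_braidClosure, map_one, wtr_eq_sum, ← Equiv.sum_comp
    (Equiv.funUnique (Fin 1) (Fin N)).symm]
  simp

/-- In `l c' (op - z) + l' c op + m`, the first condition cancels `op` and the second the identity.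
-/
theorem linkInvariant_skein {l l' m : ℂ} (h1 : l * V.c' + l' * V.c = 0)
    (h2 : m = l * V.c' * V.z) {Lp Lm L0 : OrientedLink} (h : SkeinTriple Lp Lm L0) :
    l * V.linkInvariant Lp + l' * V.linkInvariant Lm + m * V.linkInvariant L0 = 0 := by
  obtain ⟨n, hn, i, α, γ, rfl, rfl, rfl⟩ := h
  simp only [linkInvariant_braidClosure, map_mul, map_inv, rep_gen, Units.val_mul]
  have hval : (V.opUnit i).val = V.c • V.op i := rfl
  have hinv : (V.opUnit i)⁻¹.val = V.c' • (V.op i - V.z • 1) := rfl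
  rw [hval, hinv]
  simp only [mul_smul_comm, smul_mul_assoc, mul_sub, sub_mul, mul_one, map_smul, map_sub,
    smul_eq_mul]
  rw [h2]
  linear_combination V.wtr ((V.rep n α).val * V.op i * (V.rep n γ).val) * h1

end VertexModel

/-! ### The vertex models of quantum `gl_N` -/

namespace VertexModel

/-- Multiplied by `q`, the sum telescopes, because `q z q^{2b} = q^{2b+2} - q^{2b}`. -/
theorem sum_pow_weight (q z : ℂ) (hz : z * q = q * q - 1) (a N : ℕ) :
    q * ∑ b ∈ Finset.range N, q ^ (2 * b) * (if a = b then q - 1 else if a < b then z else 0) =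
      if N ≤ a then 0 else q ^ (2 * N) - q * q ^ (2 * a) := by
  induction N with
  | zero => simp
  | succ N ih =>
    rw [Finset.sum_range_succ, mul_add, ih]
    rcases lt_trichotomy a N with h | h | h
    · rw [if_neg h.not_ge, if_neg h.ne, if_pos h, if_neg (by omega)]
      linear_combination q ^ (2 * N) * hz
    · rw [if_pos h.ge, if_pos h, if_neg (by omega), h]
      ring
    · rw [if_pos h.le, if_neg h.ne', if_neg h.not_gt, if_pos (by omega)]
      ring

theorem sum_pow_even (q z : ℂ) (hz : z * q = q * q - 1) (N : ℕ) :
    z * q * ∑ b ∈ Finset.range N, q ^ (2 * b) = q ^ (2 * N) - 1 := by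
  induction N with
  | zero => simp
  | succ N ih =>
    rw [Finset.sum_range_succ, mul_add, ih]
    linear_combination q ^ (2 * N) * hz

theorem sum_pow_weight_fin (q z : ℂ) (hz : z * q = q * q - 1) {N : ℕ} (a : Fin N) :
    q * (q ^ (2 * a.1) + ∑ b : Fin N, q ^ (2 * b.1) *
      (if a = b then q - 1 else if a < b then z else 0)) = q ^ (2 * N) := by
  have h := sum_pow_weight q z hz a.1 N
  rw [if_neg (by have := a.2; omega), ← Fin.sum_univ_eq_sum_range (fun b => q ^ (2 * b) *
    (if a.1 = b then q - 1 else if a.1 < b then z else 0))] at h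
  simp only [Fin.ext_iff, Fin.lt_def]
  linear_combination h

/-- The vertex model of the vector representation of quantum `gl_N`. -/
noncomputable def standard (N : ℕ) (q : ℂ) (hq : q ≠ 0) : VertexModel N where
  q := q
  z := q - q⁻¹
  c := q⁻¹ ^ N
  c' := q ^ N
  -- The exponents `2b + 1 - N` are symmetric about `0`; the partial trace of the braiding is then
  -- `q ^ N`, which forces `c = q⁻¹ ^ N`.
  μ b := q⁻¹ ^ N * q * q ^ (2 * b.1)
  z_mul_q := by field_simp
  c_mul_c' := by rw [← mul_pow, inv_mul_cancel₀ hq, one_pow]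
  sum_pos := by
    intro a
    have h := sum_pow_weight_fin q (q - q⁻¹) (by field_simp) a
    have hc : q⁻¹ ^ N * q ^ N = 1 := by rw [← mul_pow, inv_mul_cancel₀ hq, one_pow]
    simp only [mul_assoc, ← Finset.mul_sum]
    rw [← mul_add, ← mul_add, h, two_mul, pow_add]
    linear_combination (q⁻¹ ^ N * q ^ N + 1) * hc
  sum_neg := by
    intro a
    have hz : (q - q⁻¹) * q = q * q - 1 := by field_simp
    have h := sum_pow_weight_fin q (q - q⁻¹) hz a
    have h' := sum_pow_even q (q - q⁻¹) hz N
    rw [← Fin.sum_univ_eq_sum_range (fun b => q ^ (2 * b))] at h'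
    have hc : q⁻¹ ^ N * q ^ N = 1 := by rw [← mul_pow, inv_mul_cancel₀ hq, one_pow]
    simp only [mul_assoc, ← Finset.mul_sum]
    rw [← mul_add, ← mul_add]
    linear_combination (q⁻¹ ^ N * q ^ N) * h - (q⁻¹ ^ N * q ^ N) * h' + hc

theorem standard_linkInvariant_unknot_ne_zero (N : ℕ) (q : ℂ) (hq : q ≠ 0)
    (hN : q ^ (2 * N) ≠ 1) : (standard N q hq).linkInvariant unknot ≠ 0 := by
  have h' := sum_pow_even q (q - q⁻¹) (by field_simp) N
  rw [← Fin.sum_univ_eq_sum_range (fun b => q ^ (2 * b))] at h'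
  rw [linkInvariant_unknot]
  simp only [standard, ← Finset.mul_sum]
  refine mul_ne_zero (mul_ne_zero (pow_ne_zero _ (inv_ne_zero hq)) hq) fun h => hN ?_
  rw [h, mul_zero] at h'
  exact (sub_eq_zero.1 h'.symm)

end VertexModel

/-! ### Evaluations of Laurent polynomials -/

theorem laurent_eq_zero_of_eval {A : Type*} [CommRing A] [IsDomain A] (f : LaurentPolynomial A)
    (u : ℕ → Aˣ) (hu : Function.Injective u)
    (h : ∀ k, LaurentPolynomial.eval₂ (RingHom.id A) (u k) f = 0) : f = 0 := by
  obtain ⟨n, p, hp⟩ := LaurentPolynomial.exists_T_pow f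
  have hroot : ∀ k, p.IsRoot (u k : A) := by
    intro k
    have h1 := congrArg (LaurentPolynomial.eval₂ (RingHom.id A) (u k)) hp
    rw [map_mul, h k, zero_mul, LaurentPolynomial.eval₂_toLaurent] at h1
    exact h1
  have hp0 : p = 0 := by
    apply Polynomial.eq_zero_of_infinite_isRoot
    refine (Set.infinite_range_of_injective (Units.val_injective.comp hu)).mono ?_
    rintro _ ⟨k, rfl⟩
    exact hroot k
  rw [hp0, map_zero] at hp
  exact ((LaurentPolynomial.isUnit_T (n : ℤ)).mul_left_eq_zero).1 hp.symm

/-- The evaluation `l ↦ u`, `m ↦ v` in the complex numbers. -/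
noncomputable def evalHomfly (u v : ℂˣ) : HomflyRing →+* ℂ :=
  (LaurentPolynomial.eval₂ (RingHom.id ℂ) u).comp
    (LaurentPolynomial.eval₂ (RingHom.id _) (Units.map LaurentPolynomial.C.toMonoidHom v))

theorem evalHomfly_lPow (u v : ℂˣ) (k : ℤ) : evalHomfly u v (lPow k) = (u ^ k : ℂˣ) := by
  simp [evalHomfly, lPow]

theorem evalHomfly_mPow (u v : ℂˣ) (k : ℤ) : evalHomfly u v (mPow k) = (v ^ k : ℂˣ) := by
  simp only [evalHomfly, mPow, RingHom.comp_apply, LaurentPolynomial.eval₂_T, ← map_zpow]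
  exact LaurentPolynomial.eval₂_C _ _ _

/-- The parameter `q` of the `t`-th family of vertex models. -/
def qParam (t : ℕ) : ℂ := ((t + 2 : ℕ) : ℂ)

theorem qParam_ne_zero (t : ℕ) : qParam t ≠ 0 := Nat.cast_ne_zero.2 (by omega)

theorem qParam_pow_ne_one (t k : ℕ) : qParam t ^ (2 * (k + 1)) ≠ 1 := by
  intro h
  rw [qParam] at h
  have h1 : (t + 2) ^ (2 * (k + 1)) = 1 := by exact_mod_cast h
  have h2 : 1 < (t + 2) ^ (2 * (k + 1)) := Nat.one_lt_pow (by omega) (by omega)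
  omega

theorem qParam_sub_inv_ne_zero (t : ℕ) : qParam t - (qParam t)⁻¹ ≠ 0 := by
  intro h
  have h0 := qParam_ne_zero t
  apply qParam_pow_ne_one t 0
  field_simp at h
  linear_combination h

/-- The value of `l` for the standard vertex model with parameters `t`, `k`. -/
noncomputable def lUnit (t k : ℕ) : ℂˣ :=
  -- For `N = k + 1`, the skein condition `l c' + l⁻¹ c = 0` reads `l ^ 2 = -q ^ (-2N)`. With this
  -- root, `m = l c' z` is `-ι (q - q⁻¹)`, independent of `N`.
  Units.mk0 (-Complex.I * (qParam t)⁻¹ ^ (k + 1))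
    (mul_ne_zero (neg_ne_zero.2 Complex.I_ne_zero) (pow_ne_zero _ (inv_ne_zero (qParam_ne_zero t))))

/-- The value of `m` for the standard vertex models with parameter `t`. -/
noncomputable def mUnit (t : ℕ) : ℂˣ :=
  Units.mk0 (-Complex.I * (qParam t - (qParam t)⁻¹))
    (mul_ne_zero (neg_ne_zero.2 Complex.I_ne_zero) (qParam_sub_inv_ne_zero t))

theorem lUnit_injective (t : ℕ) : Function.Injective (lUnit t) := by
  intro j k h
  have h1 := congrArg Units.val h
  simp only [lUnit, Units.val_mk0] at h1
  have h2 := mul_left_cancel₀ (neg_ne_zero.2 Complex.I_ne_zero) h1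
  rw [inv_pow, inv_pow, inv_inj, qParam] at h2
  have h3 : (t + 2) ^ (j + 1) = (t + 2) ^ (k + 1) := by exact_mod_cast h2
  have h4 := Nat.pow_right_injective (show 2 ≤ t + 2 by omega) h3
  omega

theorem mUnit_injective : Function.Injective mUnit := by
  intro s t h
  have h1 := congrArg Units.val h
  simp only [mUnit, Units.val_mk0] at h1
  have h2 := mul_left_cancel₀ (neg_ne_zero.2 Complex.I_ne_zero) h1
  have hs := qParam_ne_zero s
  have ht := qParam_ne_zero t
  have h3 : (qParam s - qParam t) * (qParam s * qParam t + 1) = 0 := by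
    field_simp at h2
    linear_combination h2
  rcases mul_eq_zero.1 h3 with h4 | h4
  · rw [qParam, qParam, sub_eq_zero, Nat.cast_inj] at h4
    omega
  · rw [qParam, qParam] at h4
    have h5 : (s + 2) * (t + 2) + 1 = 0 := by exact_mod_cast h4
    omega

/-- Since `m` depends only on `t`, for each fixed `t` infinitely many values of `l` kill the
specialization at that `m`; then infinitely many values of `m` kill `f`. -/
theorem eq_zero_of_evalHomfly (f : HomflyRing)
    (h : ∀ t k, evalHomfly (lUnit t k) (mUnit t) f = 0) : f = 0 := by
  refine laurent_eq_zero_of_eval f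
    (fun t => Units.map LaurentPolynomial.C.toMonoidHom (mUnit t)) ?_ fun t => ?_
  · intro s t hst
    have h1 := congrArg Units.val hst
    exact mUnit_injective (Units.ext (Function.LeftInverse.injective (LaurentPolynomial.eval₂_C (RingHom.id ℂ) 1) h1))
  · exact laurent_eq_zero_of_eval _ (lUnit t) (lUnit_injective t) (h t)

/-! ### Existence of the HOMFLY polynomial -/

/-- The link invariant of the standard vertex model with parameters `t`, `k`. -/
noncomputable def vertexInvariant (t k : ℕ) (L : OrientedLink) : ℂ :=
  (VertexModel.standard (k + 1) (qParam t) (qParam_ne_zero t)).linkInvariant L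

theorem vertexInvariant_skein (t k : ℕ) {Lp Lm L0 : OrientedLink} (h : SkeinTriple Lp Lm L0) :
    evalHomfly (lUnit t k) (mUnit t) (lPow 1) * vertexInvariant t k Lp +
      evalHomfly (lUnit t k) (mUnit t) (lPow (-1)) * vertexInvariant t k Lm +
      evalHomfly (lUnit t k) (mUnit t) (mPow 1) * vertexInvariant t k L0 = 0 := by
  have hq := qParam_ne_zero t
  have hI := Complex.I_mul_I
  have hpow : (qParam t)⁻¹ ^ (k + 1) * qParam t ^ (k + 1) = 1 := by
    rw [← mul_pow, inv_mul_cancel₀ hq, one_pow]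
  have hl : evalHomfly (lUnit t k) (mUnit t) (lPow 1) = -Complex.I * (qParam t)⁻¹ ^ (k + 1) := by
    rw [evalHomfly_lPow, zpow_one]; rfl
  have hl' : evalHomfly (lUnit t k) (mUnit t) (lPow (-1)) = Complex.I * qParam t ^ (k + 1) := by
    rw [evalHomfly_lPow, zpow_neg_one, Units.val_inv_eq_inv_val]
    apply inv_eq_of_mul_eq_one_left
    change Complex.I * qParam t ^ (k + 1) * (-Complex.I * (qParam t)⁻¹ ^ (k + 1)) = 1
    linear_combination (-((qParam t)⁻¹ ^ (k + 1) * qParam t ^ (k + 1))) * hI + hpow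
  have hm : evalHomfly (lUnit t k) (mUnit t) (mPow 1) =
      -Complex.I * (qParam t - (qParam t)⁻¹) := by
    rw [evalHomfly_mPow, zpow_one]; rfl
  refine VertexModel.linkInvariant_skein _ ?_ ?_ h
  · rw [hl, hl']
    simp only [VertexModel.standard]
    ring
  · rw [hl, hm]
    simp only [VertexModel.standard]
    linear_combination (Complex.I * (qParam t - (qParam t)⁻¹)) * hpow

theorem vertexInvariant_unknot_ne_zero (t k : ℕ) : vertexInvariant t k unknot ≠ 0 :=
  VertexModel.standard_linkInvariant_unknot_ne_zero _ _ _ (qParam_pow_ne_one t k)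

theorem exists_eval_eq_vertexInvariant (L : OrientedLink) : ∃ r : HomflyRing, ∀ t k,
    evalHomfly (lUnit t k) (mUnit t) r * vertexInvariant t k unknot = vertexInvariant t k L := by
  -- The ring acts on families of complex numbers through all the evaluations at once, so that a
  -- single `r` serves every pair of parameters.
  let _ : Module HomflyRing (ℕ × ℕ → ℂ) := Module.compHom _
    (RingHom.pi fun p : ℕ × ℕ => evalHomfly (lUnit p.1 p.2) (mUnit p.1))
  have hsmul : ∀ (r : HomflyRing) (v : ℕ × ℕ → ℂ) (p : ℕ × ℕ),
      (r • v) p = evalHomfly (lUnit p.1 p.2) (mUnit p.1) r * v p := fun _ _ _ => rfl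
  have hs : IsSkeinInvariant (lPow 1) (lPow (-1)) (mPow 1)
      fun L => fun p : ℕ × ℕ => vertexInvariant p.1 p.2 L := by
    intro Lp Lm L0 h
    funext p
    simp only [Pi.add_apply, hsmul]
    exact vertexInvariant_skein p.1 p.2 h
  obtain ⟨r, hr⟩ := Submodule.mem_span_singleton.1
    (hs.mem_span_unknot lPow_mul_neg mPow_mul_neg L)
  exact ⟨r, fun t k => congrFun hr (t, k)⟩

/-- The state sums are nonzero on the unknot, so each required identity can be checked after
multiplying its evaluations by that value, where it becomes one between state sums. -/
theorem exists_isHomfly : ∃ P : OrientedLink → HomflyRing, IsHomfly P := by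
  choose P hP using exists_eval_eq_vertexInvariant
  refine ⟨P, ?_, fun Lp Lm L0 h => ?_⟩
  · rw [← sub_eq_zero]
    refine eq_zero_of_evalHomfly _ fun t k => ?_
    refine mul_right_cancel₀ (vertexInvariant_unknot_ne_zero t k) ?_
    rw [map_sub, map_one, sub_mul, hP, one_mul, sub_self, zero_mul]
  · refine eq_zero_of_evalHomfly _ fun t k => ?_
    refine mul_right_cancel₀ (vertexInvariant_unknot_ne_zero t k) ?_
    rw [map_add, map_add, map_mul, map_mul, map_mul, add_mul, add_mul, mul_assoc, mul_assoc,
      mul_assoc, hP, hP, hP, zero_mul]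
    exact vertexInvariant_skein t k h

end SimpleBraid

theorem theorem1p10 :
    -- (a) conjugacy classes of simple braids
    (∀ (n : ℕ) (β : BraidGroup n), β ∈ positiveBraids n →
      (IsSimple β ↔
        ∃ A : List ℕ, A.Pairwise (fun a b => a ≥ b) ∧ (∀ a ∈ A, 2 ≤ a) ∧ A.sum ≤ n ∧
          IsConj β (canonicalBraid n A))) ∧
    -- the HOMFLY polynomial exists and is unique
    (∃! P : OrientedLink → HomflyRing, IsHomfly P) ∧
    -- (b) its values, and those of its specializations, on closed simple braids
    (∀ P : OrientedLink → HomflyRing, IsHomfly P → ∀ (n : ℕ) (hn : 0 < n),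
      (∀ A : List ℕ, A.Pairwise (fun a b => a ≥ b) → (∀ a ∈ A, 2 ≤ a) → A.sum ≤ n →
        P (braidClosure hn (canonicalBraid n A)) = delta ^ (n - A.sum + A.length - 1)) ∧
      (∀ β : BraidGroup n, IsSimple β →
        ∃ k : ℕ, (k : ℤ) = n - degree β - 1 ∧
          P (braidClosure hn β) = delta ^ k ∧
          conway P (braidClosure hn β) = (if degree β = n - 1 then 1 else 0) ∧
          jones P (braidClosure hn β) = (-((sVar ^ 2 + 1) / sVar)) ^ k ∧
          dPoly P (braidClosure hn β) = ((sVar ^ 2 + 1) / (2 * sVar)) ^ k)) := by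
  refine ⟨fun n β hβ => ⟨fun h => h.exists_isConj, ?_⟩, ?_, fun P hP n hn => ⟨?_, ?_⟩⟩
  · rintro ⟨A, -, hA, hsum, hconj⟩
    exact IsSimple.of_isConj hβ
      (isSimple_canonicalBraid A (fun a ha => one_le_two.trans (hA a ha)) hsum) hconj
  · obtain ⟨P, hP⟩ := exists_isHomfly
    exact ⟨P, hP, fun P' hP' => hP'.unique hP⟩
  · intro A _ hA hsum
    exact hP.canonicalBraid hn A (fun a ha => one_le_two.trans (hA a ha)) hsum
  · intro β hβ
    obtain ⟨k, hk, hval⟩ := hP.isSimple hn hβ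
    refine ⟨k, hk, hval, ?_, ?_, ?_⟩
    · rw [conway, hval, map_pow, specialize_conway_delta _ _ (Units.val_mk0 _)]
      split_ifs with h
      · obtain rfl : k = 0 := by omega
        exact pow_zero _
      · exact zero_pow (by omega)
    · rw [jones, hval, map_pow, specialize_jones_delta _ _ (Units.val_mk0 _) (Units.val_mk0 _)]
    · rw [dPoly, hval, map_pow, specialize_dPoly_delta _ _ (Units.val_mk0 _) (Units.val_mk0 _)]
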